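/- **Setting.** Let $\mathcal J^2=\mathbb R\times\mathbb R^n\times\mathcal S(n)$ be the space of 2-jets $J=(r,p,A)$, where $\mathcal S(n)$ is the space of real symmetric $n\times n$ matrices, with the inner product $\langle (a,b,E),(r,p,A)\rangle=\operatorname{tr}(EA)+\langle b,p\rangle+ar$ and its norm $\|\cdot\|$. Put $\mathcal N=(-\infty,0]$, $\mathcal P=\{A\in\mathcal S(n):A\ge 0\}$. A *subequation* is a nonempty proper subset $\mathcal F\subsetneq\mathcal J^2$ with (P) $\mathcal F+(\{0\}\times\{0\}\times\mathcal P)\subset\mathcal F$, (N) $\mathcal F+(\mathcal N\times\{0\}\times\{0\})\subset\mathcal F$ and (T) $\mathcal F=\overline{\operatorname{Int}\mathcal F}$. It is a *convex cone subequation* if it is also a convex cone with vertex $0$. A *monotonicity cone subequation* is a closed convex cone $\mathcal M\supset\mathcal N\times\{0\}\times\mathcal P$ with (T); $\mathcal F$ is $\mathcal M$-monotone if $\mathcal F+\mathcal M\subset\mathcal F$. The *maximal monotonicity cone* of $\mathcal F$ is $\mathcal M_{\mathcal F}=\{J:\mathcal F+tJ\subset\mathcal F\ \forall t\in[0,1]\}$.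 If a subequation $\mathcal F$ is $\mathcal M$-monotone for a monotonicity cone subequation $\mathcal M$ and $J_0\in\operatorname{Int}\mathcal M$, the *canonical operator* of $\mathcal F$ determined by $J_0$ is $F(J)=-t_J$, where $t_J$ is the unique real number with $J+t_JJ_0\in\partial\mathcal F$. The *polar* of $\mathcal M$ is $\mathcal M^\circ=\{J:\langle J,J'\rangle\ge0\ \forall J'\in\mathcal M\}$. A *directional cone* is a closed convex cone $\mathcal D\subseteq\mathbb R^n$ with vertex $0$ and nonempty interior (possibly $\mathcal D=\mathbb R^n$). For $\gamma\in[0,\infty)$, $R\in(0,\infty)$ and a directional cone $\mathcal D$ let $$\mathcal M(\gamma)=\{r\le-\gamma|p|\},\quad \mathcal M(\mathcal P)=\{A\ge0\},\quad \mathcal M(\mathcal D)=\{p\in\mathcal D\},\quad \mathcal M(R)=\{A\ge\tfrac{|p|}{R}I\},$$ and let several arguments denote intersections, e.g. $\mathcal M(\gamma,\mathcal D,R)=\mathcal M(\gamma)\cap\mathcal M(\mathcal D)\cap\mathcal M(R)$. Let $S=\{J_\sigma\}_{\sigma\in\Sigma}$ be a nonempty family of nonzero vectors in $\mathcal N\times\mathbb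 R^n\times\mathcal P$. It is *pointed with axis* $J_0\ne0$ if there is $\varepsilon>0$ with $\langle J_\sigma,J_0\rangle\ge\varepsilon\|J_\sigma\|$ for all $\sigma$. Put $\mathcal F_\sigma=\{J:\langle J_\sigma,J\rangle\ge0\}$ and $\mathcal F=\bigcap_\sigma\mathcal F_\sigma$. Let $u$ be upper semicontinuous on $\overline\Omega$ with values in $[-\infty,\infty)$ and $w$ lower semicontinuous on $\overline\Omega$ with values in $(-\infty,\infty]$. For $F:\mathcal J^2\to\mathbb R$, $u$ is a viscosity subsolution of $F(u,Du,D^2u)=c$ in $\Omega$ if $F(\varphi(x_0),D\varphi(x_0),D^2\varphi(x_0))\ge c$ whenever $x_0\in\Omega$, $\varphi$ is $C^2$ near $x_0$, $u\le\varphi$ near $x_0$ and $u(x_0)=\varphi(x_0)$; supersolutions $w$ are defined with both inequalities reversed. *Comparison holds for $F=c$ on $\Omega$* if for all such subsolution/supersolution pairs $u,w$: $u\le w$ on $\partial\Omega$ implies $u\le w$ on $\Omega$. **Theorem.** (1) $\mathcal F$ is a convex cone, and it is a subequation if and only if $S$ is pointed with some axis $J_0\ne0$. (2) Suppose $S$ is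 pointed with axis $J_0$. Then each $\mathcal F_\sigma$ is a convex cone subequation whose canonical operator determined by $J_0$ is $\overline F_\sigma(J)=\langle J_\sigma,J\rangle/\langle J_\sigma,J_0\rangle$; $\mathcal F$ is a convex cone subequation with $\mathcal M_{\mathcal F}=\mathcal F$; the infimum $F(J)=\inf_\sigma\overline F_\sigma(J)$ is finite for every $J$, and $F$ is the canonical operator of $\mathcal F$ determined by $J_0$. Moreover $F$ is concave and continuous on $\mathcal J^2$. (3) In the situation of (2), suppose $S\subset\mathcal M^\circ$, where $\mathcal M$ is one of $\mathcal M(\gamma)$, $\mathcal M(\mathcal P)$, $\mathcal M(\mathcal D)$, $\mathcal M(\gamma,\mathcal D)$, $\mathcal M(\gamma,\mathcal P)$, $\mathcal M(\mathcal D,\mathcal P)$, $\mathcal M(\gamma,\mathcal D,\mathcal P)$. Then for every $c\in\mathbb R$ comparison holds for $F=c$ on every bounded open set $\Omega\subset\mathbb R^n$. (4) In the situation of (2), suppose $S\subset\mathcal M^\circ$, where $\mathcal M$ is one of $\mathcal M(R)$, $\mathcal M(\gamma,R)$, $\mathcal M(\mathcal D,R)$, $\mathcal M(\gamma,\mathcal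 D,R)$ with $R\in(0,\infty)$. Then for every $c\in\mathbb R$ comparison holds for $F=c$ on every open set $\Omega$ contained in a translate of $\mathcal D\cap B_R(0)$, where $\mathcal D=\mathbb R^n$ for $\mathcal M(R)$ and $\mathcal M(\gamma,R)$. -/

import Mathlib

open Set Filter Topology

noncomputable section

/-- The space `S(n)` of real symmetric `n × n` matrices. -/
def symMat (n : ℕ) : Submodule ℝ (Matrix (Fin n) (Fin n) ℝ) where
  carrier := {A | A.IsSymm}
  add_mem' := fun ha hb => Matrix.IsSymm.add ha hb
  zero_mem' := Matrix.isSymm_zero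
  smul_mem' := fun c _ ha => Matrix.IsSymm.smul ha c

/-- The space of 2-jets `𝒥² = ℝ × ℝⁿ × S(n)`, with its product topology; a jet is
`J = (r, p, A)`. -/
abbrev Jet (n : ℕ) : Type := ℝ × EuclideanSpace ℝ (Fin n) × symMat n

variable {n : ℕ}

/-- `⟨(a, b, E), (r, p, A)⟩ = tr(EA) + ⟨b, p⟩ + ar`. -/
def jetInner (J J' : Jet n) : ℝ :=
  Matrix.trace ((J.2.2 : Matrix (Fin n) (Fin n) ℝ) * (J'.2.2 : Matrix (Fin n) (Fin n) ℝ))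
    + inner ℝ J.2.1 J'.2.1 + J.1 * J'.1

/-- The norm of the inner product `jetInner`. -/
def jetNorm (J : Jet n) : ℝ := Real.sqrt (jetInner J J)

/-- The cone `𝒫` of nonnegative symmetric matrices. -/
def psd (n : ℕ) : Set (symMat n) := {A | (A : Matrix (Fin n) (Fin n) ℝ).PosSemidef}

/-- The proper elliptic coefficient vectors `𝒩 × ℝⁿ × 𝒫`. -/
def properEllipticCoeffs (n : ℕ) : Set (Jet n) := {J | J.1 ≤ 0 ∧ J.2.2 ∈ psd n}

/-- The minimal monotonicity set `𝓜₀ = 𝒩 × {0} × 𝒫`. -/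
def minimalMonotonicitySet (n : ℕ) : Set (Jet n) := {J | J.1 ≤ 0 ∧ J.2.1 = 0 ∧ J.2.2 ∈ psd n}

/-! ### Subequations, monotonicity cones, polars -/

/-- A subequation (constraint set): a nonempty proper subset of `𝒥²` with the positivity,
negativity and topological conditions (P), (N), (T). -/
structure IsSubequation (𝓕 : Set (Jet n)) : Prop where
  nonempty : 𝓕.Nonempty
  ne_univ : 𝓕 ≠ univ
  positivity : ∀ (r : ℝ) (p : EuclideanSpace ℝ (Fin n)) (A P : symMat n),
    (r, p, A) ∈ 𝓕 → P ∈ psd n → (r, p, A + P) ∈ 𝓕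
  negativity : ∀ (r s : ℝ) (p : EuclideanSpace ℝ (Fin n)) (A : symMat n),
    (r, p, A) ∈ 𝓕 → s ≤ 0 → (r + s, p, A) ∈ 𝓕
  topological : 𝓕 = closure (interior 𝓕)

/-- A convex cone with vertex at the origin. -/
def IsConvexCone {V : Type*} [AddCommGroup V] [Module ℝ V] (C : Set V) : Prop :=
  C.Nonempty ∧ Convex ℝ C ∧ ∀ t : ℝ, 0 ≤ t → ∀ x ∈ C, t • x ∈ C

/-- A convex cone subequation. -/
def IsConvexConeSubequation (𝓕 : Set (Jet n)) : Prop := IsSubequation 𝓕 ∧ IsConvexCone 𝓕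

/-- A monotonicity cone subequation: a closed convex cone that contains `𝓜₀` and satisfies the
topological condition (T). -/
def IsMonotonicityConeSubequation (𝓜 : Set (Jet n)) : Prop :=
  IsClosed 𝓜 ∧ IsConvexCone 𝓜 ∧ minimalMonotonicitySet n ⊆ 𝓜 ∧ 𝓜 = closure (interior 𝓜)

/-- `𝓕` is `𝓜`-monotone: `𝓕 + 𝓜 ⊆ 𝓕`. -/
def IsMonotoneFor (𝓕 𝓜 : Set (Jet n)) : Prop := ∀ J ∈ 𝓕, ∀ J' ∈ 𝓜, J + J' ∈ 𝓕

/-- The maximal monotonicity cone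
`𝓜_𝓕 = {J : 𝓕 + tJ ⊆ 𝓕 for each t ∈ [0, 1]}`. -/
def maxMonotonicityCone (𝓕 : Set (Jet n)) : Set (Jet n) :=
  {J | ∀ t ∈ Icc (0 : ℝ) 1, ∀ J' ∈ 𝓕, J' + t • J ∈ 𝓕}

/-- The convex cone polar `T° = {J : ⟨J, J'⟩ ≥ 0 for all J' ∈ T}`. -/
def polarCone (T : Set (Jet n)) : Set (Jet n) := {J | ∀ J' ∈ T, 0 ≤ jetInner J J'}

/-- `F` is the canonical operator for `𝓕` determined by `J₀`: the vector `J₀` is interior to some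
monotonicity cone subequation for `𝓕`, and `F(J) = -t_J`, where `t_J` is the unique real number
with `J + t_J J₀ ∈ ∂𝓕`. -/
def IsCanonicalOperator (𝓕 : Set (Jet n)) (J₀ : Jet n) (F : Jet n → ℝ) : Prop :=
  (∃ 𝓜 : Set (Jet n), IsMonotonicityConeSubequation 𝓜 ∧ IsMonotoneFor 𝓕 𝓜 ∧ J₀ ∈ interior 𝓜) ∧
    ∀ (J : Jet n) (t : ℝ), J + t • J₀ ∈ frontier 𝓕 ↔ t = -F J

/-! ### The fundamental family of monotonicity cones -/

/-- A directional cone: a closed convex cone in `ℝⁿ` (possibly all of `ℝⁿ`) with vertex at the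
origin and nonempty interior. -/
def IsDirectionalCone (𝓓 : Set (EuclideanSpace ℝ (Fin n))) : Prop :=
  IsClosed 𝓓 ∧ IsConvexCone 𝓓 ∧ (interior 𝓓).Nonempty

/-- `𝓜(γ) = {r ≤ -γ|p|}`; for `γ = 0` this is `𝓜(𝒩)`. -/
def coneGamma (γ : ℝ) : Set (Jet n) := {J | J.1 ≤ -γ * ‖J.2.1‖}

/-- `𝓜(𝒫) = {A ≥ 0}`. -/
def conePsd (n : ℕ) : Set (Jet n) := {J | J.2.2 ∈ psd n}

/-- `𝓜(𝓓) = {p ∈ 𝓓}`. -/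
def coneDir (𝓓 : Set (EuclideanSpace ℝ (Fin n))) : Set (Jet n) := {J | J.2.1 ∈ 𝓓}

/-- `𝓜(R) = {A ≥ (|p|/R) I}`. -/
def coneR (R : ℝ) : Set (Jet n) :=
  {J | ((J.2.2 : Matrix (Fin n) (Fin n) ℝ)
    - (‖J.2.1‖ / R) • (1 : Matrix (Fin n) (Fin n) ℝ)).PosSemidef}

/-- The cones of the fundamental family with `R = +∞`. -/
inductive IsConeInfiniteR : Set (Jet n) → Prop
  | gamma (γ : ℝ) (hγ : 0 ≤ γ) : IsConeInfiniteR (coneGamma γ)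
  | psd : IsConeInfiniteR (conePsd n)
  | dir (𝓓 : Set (EuclideanSpace ℝ (Fin n))) (h𝓓 : IsDirectionalCone 𝓓) :
      IsConeInfiniteR (coneDir 𝓓)
  | gamma_dir (γ : ℝ) (hγ : 0 ≤ γ) (𝓓 : Set (EuclideanSpace ℝ (Fin n)))
      (h𝓓 : IsDirectionalCone 𝓓) : IsConeInfiniteR (coneGamma γ ∩ coneDir 𝓓)
  | gamma_psd (γ : ℝ) (hγ : 0 ≤ γ) : IsConeInfiniteR (coneGamma γ ∩ conePsd n)
  | dir_psd (𝓓 : Set (EuclideanSpace ℝ (Fin n))) (h𝓓 : IsDirectionalCone 𝓓) :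
      IsConeInfiniteR (coneDir 𝓓 ∩ conePsd n)
  | gamma_dir_psd (γ : ℝ) (hγ : 0 ≤ γ) (𝓓 : Set (EuclideanSpace ℝ (Fin n)))
      (h𝓓 : IsDirectionalCone 𝓓) : IsConeInfiniteR (coneGamma γ ∩ coneDir 𝓓 ∩ conePsd n)

/-- `IsConeFiniteR R 𝓓 𝓜`: the set `𝓜` is one of the cones of the fundamental family with finite
parameter `R` and with directional cone `𝓓`, where `𝓓 = ℝⁿ` if no directional cone enters. -/
inductive IsConeFiniteR (R : ℝ) : Set (EuclideanSpace ℝ (Fin n)) → Set (Jet n) → Prop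
  | ball : IsConeFiniteR R univ (coneR R)
  | gamma (γ : ℝ) (hγ : 0 ≤ γ) : IsConeFiniteR R univ (coneGamma γ ∩ coneR R)
  | dir (𝓓 : Set (EuclideanSpace ℝ (Fin n))) (h𝓓 : IsDirectionalCone 𝓓) :
      IsConeFiniteR R 𝓓 (coneDir 𝓓 ∩ coneR R)
  | gamma_dir (γ : ℝ) (hγ : 0 ≤ γ) (𝓓 : Set (EuclideanSpace ℝ (Fin n)))
      (h𝓓 : IsDirectionalCone 𝓓) : IsConeFiniteR R 𝓓 (coneGamma γ ∩ coneDir 𝓓 ∩ coneR R)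

/-! ### Pointed families and the Hamilton-Jacobi-Bellman operator -/

/-- The family `S` is pointed with axis `J₀`. -/
def IsPointedWithAxis {ι : Type*} (S : ι → Jet n) (J₀ : Jet n) : Prop :=
  J₀ ≠ 0 ∧ ∃ ε : ℝ, 0 < ε ∧ ∀ σ, ε * jetNorm (S σ) ≤ jetInner (S σ) J₀

/-- The half-space `{J : ⟨J', J⟩ ≥ 0}`. -/
def halfSpace (J' : Jet n) : Set (Jet n) := {J | 0 ≤ jetInner J' J}

/-- The linear operator `J ↦ ⟨J', J⟩ / ⟨J', J₀⟩`. -/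
def normalizedOp (J' J₀ : Jet n) (J : Jet n) : ℝ := jetInner J' J / jetInner J' J₀

/-- The operator `F(J) = inf_σ ⟨J_σ, J⟩ / ⟨J_σ, J₀⟩`. -/
def hjbOp {ι : Type*} (S : ι → Jet n) (J₀ : Jet n) (J : Jet n) : ℝ :=
  ⨅ σ, normalizedOp (S σ) J₀ J

/-! ### Viscosity subsolutions and supersolutions, comparison -/

/-- The Hessian matrix of `φ` at `x`. -/
def hessianMatrix (φ : EuclideanSpace ℝ (Fin n) → ℝ) (x : EuclideanSpace ℝ (Fin n)) :
    Matrix (Fin n) (Fin n) ℝ :=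
  Matrix.of fun i j =>
    fderiv ℝ (fderiv ℝ φ) x (EuclideanSpace.single i 1) (EuclideanSpace.single j 1)

/-- `J` is the 2-jet `(φ(x), Dφ(x), D²φ(x))` of a function `φ` that is `C²` near `x`. -/
def IsTwoJet (φ : EuclideanSpace ℝ (Fin n) → ℝ) (x : EuclideanSpace ℝ (Fin n))
    (J : Jet n) : Prop :=
  ContDiffAt ℝ 2 φ x ∧ J.1 = φ x ∧ J.2.1 = gradient φ x ∧
    (J.2.2 : Matrix (Fin n) (Fin n) ℝ) = hessianMatrix φ x

/-- The 2-jets at `x` of the `C²` upper test functions for `u` at `x`. -/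
def upperTestJets (u : EuclideanSpace ℝ (Fin n) → EReal) (x : EuclideanSpace ℝ (Fin n)) :
    Set (Jet n) :=
  {J | ∃ φ : EuclideanSpace ℝ (Fin n) → ℝ,
    IsTwoJet φ x J ∧ (∀ᶠ y in 𝓝 x, u y ≤ (φ y : EReal)) ∧ u x = (φ x : EReal)}

/-- The 2-jets at `x` of the `C²` lower test functions for `w` at `x`. -/
def lowerTestJets (w : EuclideanSpace ℝ (Fin n) → EReal) (x : EuclideanSpace ℝ (Fin n)) :
    Set (Jet n) :=
  {J | ∃ φ : EuclideanSpace ℝ (Fin n) → ℝ,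
    IsTwoJet φ x J ∧ (∀ᶠ y in 𝓝 x, (φ y : EReal) ≤ w y) ∧ w x = (φ x : EReal)}

/-- `u` is a viscosity subsolution of `F(u, Du, D²u) = c` in `Ω`. -/
def IsViscositySubsolution (F : Jet n → ℝ) (c : ℝ) (Ω : Set (EuclideanSpace ℝ (Fin n)))
    (u : EuclideanSpace ℝ (Fin n) → EReal) : Prop :=
  ∀ x ∈ Ω, ∀ J ∈ upperTestJets u x, c ≤ F J

/-- `w` is a viscosity supersolution of `F(w, Dw, D²w) = c` in `Ω`. -/
def IsViscositySupersolution (F : Jet n → ℝ) (c : ℝ) (Ω : Set (EuclideanSpace ℝ (Fin n)))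
    (w : EuclideanSpace ℝ (Fin n) → EReal) : Prop :=
  ∀ x ∈ Ω, ∀ J ∈ lowerTestJets w x, F J ≤ c

/-- `u ∈ USC(K)`, with values in `[-∞, +∞)`. -/
def IsUSC (K : Set (EuclideanSpace ℝ (Fin n))) (u : EuclideanSpace ℝ (Fin n) → EReal) : Prop :=
  UpperSemicontinuousOn u K ∧ ∀ x ∈ K, u x ≠ ⊤

/-- `w ∈ LSC(K)`, with values in `(-∞, +∞]`. -/
def IsLSC (K : Set (EuclideanSpace ℝ (Fin n))) (w : EuclideanSpace ℝ (Fin n) → EReal) : Prop :=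
  LowerSemicontinuousOn w K ∧ ∀ x ∈ K, w x ≠ ⊥

/-- The comparison principle on `Ω` for the equation `F(u, Du, D²u) = c`. -/
def ComparisonPrinciple (F : Jet n → ℝ) (c : ℝ) (Ω : Set (EuclideanSpace ℝ (Fin n))) : Prop :=
  ∀ u w : EuclideanSpace ℝ (Fin n) → EReal,
    IsUSC (closure Ω) u → IsLSC (closure Ω) w →
    IsViscositySubsolution F c Ω u → IsViscositySupersolution F c Ω w →
    (∀ x ∈ frontier Ω, u x ≤ w x) → ∀ x ∈ Ω, u x ≤ w x

end

/-! Pointedness and Cauchy-Schwarz make the functionals `normalizedOp (S σ) J₀` uniformly Lipschitz.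
Their infimum $F$ is therefore finite, concave and continuous; moreover $F(J+tJ_0)=F(J)+t$ and
$\mathcal F=\{F\ge0\}$, which gives the structural statements. Conversely, an interior point $J_0$
of $\mathcal F$ is an axis, because $J_0-tJ_\sigma/\|J_\sigma\|$ stays in $\mathcal F$ for some
$t>0$ independent of $\sigma$.

Comparison rests on two facts. First, $F\ge c$ is a family of linear inequalities with constant
coefficients, $\langle J_\sigma,J\rangle\ge c\langle J_\sigma,J_0\rangle$ (`le_hjbOp_iff`), so
subsolutions can be smoothed. Sup-convolution gives a semiconvex subsolution; by Alexandrov's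
theorem the inequalities then hold almost everywhere, and mollification preserves them, since the
singular part of the Hessian of a semiconvex function has the favourable sign
(`exists_smooth_subsolution`). Second, $\psi=|x-y|^2/2-C$, with suitable $y$ and $C$, has its jets
in the interior of $\mathcal M(\gamma,\mathcal D,R)$. All the cones considered contain such a cone,
so $S\subset\mathcal M^\circ$ gives $F(\psi,D\psi,D^2\psi)>0$ (`hjbOp_paraJet_pos`).

If $u>w$ somewhere, let $v$ be a smooth approximation of $u$ and $\eta>0$ small. Then $v+\eta\psi-w$
has a positive interior maximum $M$, and $v+\eta\psi-M$ is itself a $C^2$ lower test function for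
$w$, at which $F>c$. This contradicts the supersolution property (`comparisonPrinciple_of_paraJet`);
no doubling of variables is needed. -/

/-! ### Alexandrov's theorem for semiconvex functions. -/

section Alexandrov

open MeasureTheory Asymptotics

variable {E : Type*} [NormedAddCommGroup E] [InnerProductSpace ℝ E]

/-- At each point `x`, the function `f` lies above a concave paraboloid with slope `q x` and
opening `lam` that touches it at `x`. -/
def HasQuadSupport (f : E → ℝ) (q : E → E) (lam : ℝ) : Prop :=
  ∀ x y, f x + inner ℝ (q x) (y - x) - lam / 2 * ‖y - x‖ ^ 2 ≤ f y

theorem HasQuadSupport.add_sq {f : E → ℝ} {q : E → E} {lam : ℝ} (h : HasQuadSupport f q lam) :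
    HasQuadSupport (fun x => f x + lam / 2 * ‖x‖ ^ 2) (fun x => q x + lam • x) 0 := by
  intro x y
  have h1 := h x y
  have h2 : ‖y‖ ^ 2 = ‖x‖ ^ 2 + 2 * inner ℝ x (y - x) + ‖y - x‖ ^ 2 := by
    rw [← norm_add_sq_real]; simp
  simp only [inner_add_left, real_inner_smul_left]
  rw [h2]
  linarith

/-- Splitting $[0,1]$ into $N$ equal steps leaves a total quadratic error $K/N$, which vanishes in
the limit. It replaces the mean value inequality where only subgradients are at hand. -/
theorem abs_sub_le_of_quadratic_increments {ψ : ℝ → ℝ} {C K : ℝ}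
    (h : ∀ s t, 0 ≤ s → s ≤ t → t ≤ 1 → |ψ t - ψ s| ≤ C * (t - s) + K * (t - s) ^ 2) :
    |ψ 1 - ψ 0| ≤ C := by
  have key : ∀ N : ℕ, 0 < N → |ψ 1 - ψ 0| ≤ C + K * (1 / (N : ℝ)) := by
    intro N hN
    have hN' : (0 : ℝ) < N := by exact_mod_cast hN
    have ind : ∀ k : ℕ, k ≤ N →
        |ψ (k / N) - ψ 0| ≤ k * (C * (1 / N) + K * (1 / (N : ℝ)) ^ 2) := by
      intro k
      induction k with
      | zero => intro _; simp
      | succ k ih =>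
        intro hk
        have h1 := ih (by omega)
        have e : ((k + 1 : ℕ) : ℝ) / N - k / N = 1 / N := by push_cast; field_simp; ring
        have h2 := h (k / N) ((k + 1 : ℕ) / N) (by positivity)
          (by gcongr; omega) (by rw [div_le_one hN']; exact_mod_cast hk)
        rw [e] at h2
        have h3 := abs_sub_le (ψ ((k + 1 : ℕ) / N)) (ψ (k / N)) (ψ 0)
        push_cast at h2 h3 ⊢
        linarith
    have h1 := ind N le_rfl
    rw [div_self hN'.ne'] at h1
    refine h1.trans (le_of_eq ?_)
    field_simp
  have lim : Tendsto (fun N : ℕ => C + K * (1 / (N : ℝ))) atTop (𝓝 (C + K * 0)) :=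
    (tendsto_one_div_atTop_nhds_zero_nat.const_mul K).const_add C
  rw [mul_zero, add_zero] at lim
  exact ge_of_tendsto lim (eventually_atTop.2 ⟨1, fun N hN => key N hN⟩)

/-- A function whose subgradient selection is differentiable at a point has a second order
expansion there. -/
theorem HasQuadSupport.expansion_of_hasFDerivAt {g : E → ℝ} {q : E → E}
    (hq : HasQuadSupport g q 0) {B : E →L[ℝ] E} {x : E} (hB : HasFDerivAt q B x) :
    (fun h => g (x + h) - g x - inner ℝ (q x) h - 1 / 2 * inner ℝ (B h) h)
      =o[𝓝 0] fun h => ‖h‖ ^ 2 := by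
  rw [isLittleO_iff]
  intro ε hε
  rw [hasFDerivAt_iff_isLittleO_nhds_zero, isLittleO_iff] at hB
  obtain ⟨r, hr, hball⟩ := Metric.eventually_nhds_iff_ball.1 (hB hε)
  refine Metric.eventually_nhds_iff_ball.2 ⟨r, hr, fun h hh => ?_⟩
  rw [mem_ball_zero_iff] at hh
  have bound : ∀ t : ℝ, 0 ≤ t → t ≤ 1 →
      |inner ℝ (q (x + t • h)) h - inner ℝ (q x) h - t * inner ℝ (B h) h| ≤ ε * ‖h‖ ^ 2 := by
    intro t h0 h1
    have hn : ‖t • h‖ ≤ ‖h‖ := by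
      rw [norm_smul, Real.norm_of_nonneg h0]
      exact mul_le_of_le_one_left (norm_nonneg _) h1
    have h2 := hball (t • h) (by rw [mem_ball_zero_iff]; exact hn.trans_lt hh)
    have h3 : inner ℝ (q (x + t • h)) h - inner ℝ (q x) h - t * inner ℝ (B h) h
        = inner ℝ (q (x + t • h) - q x - B (t • h)) h := by
      simp [inner_sub_left, real_inner_smul_left]
    rw [h3]
    calc _ ≤ ‖q (x + t • h) - q x - B (t • h)‖ * ‖h‖ := abs_real_inner_le_norm _ _
      _ ≤ (ε * ‖h‖) * ‖h‖ := by gcongr; exact h2.trans (by gcongr)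
      _ = ε * ‖h‖ ^ 2 := by ring
  -- The subgradient inequalities at both ends squeeze $g(x+th)-g(x+sh)$ between $(t-s)\langle
  -- q(x+sh),h\rangle$ and $(t-s)\langle q(x+th),h\rangle$. The constant $K$ pays for replacing
  -- $(t^2-s^2)/2$ by $t(t-s)$ or $s(t-s)$.
  have main := abs_sub_le_of_quadratic_increments
    (ψ := fun t => g (x + t • h) - t * inner ℝ (q x) h - t ^ 2 / 2 * inner ℝ (B h) h)
    (C := ε * ‖h‖ ^ 2) (K := |inner ℝ (B h) h| / 2) (by
      intro s t hs hst ht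
      have a1 := hq (x + t • h) (x + s • h)
      have a2 := hq (x + s • h) (x + t • h)
      have e1 : x + s • h - (x + t • h) = (s - t) • h := by rw [sub_smul]; abel
      have e2 : x + t • h - (x + s • h) = (t - s) • h := by rw [sub_smul]; abel
      rw [e1, real_inner_smul_right] at a1
      rw [e2, real_inner_smul_right] at a2
      have b1 := mul_le_mul_of_nonneg_left (abs_le.1 (bound t (hs.trans hst) ht)).2
        (sub_nonneg.2 hst)
      have b2 := mul_le_mul_of_nonneg_left (abs_le.1 (bound s hs (hst.trans ht))).1
        (sub_nonneg.2 hst)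
      have c1 := mul_le_mul_of_nonneg_left (le_abs_self (inner ℝ (B h) h))
        (sq_nonneg (t - s))
      have c2 := mul_le_mul_of_nonneg_left (neg_abs_le (inner ℝ (B h) h))
        (sq_nonneg (t - s))
      rw [abs_le]
      constructor <;> nlinarith)
  simp only [one_smul, zero_smul, add_zero] at main
  rw [Real.norm_eq_abs, Real.norm_of_nonneg (by positivity : (0 : ℝ) ≤ ‖h‖ ^ 2)]
  convert main using 2
  ring

variable [FiniteDimensional ℝ E]

/-- The proximal point of `z` for a function with subgradients everywhere. -/
theorem HasQuadSupport.exists_prox {g : E → ℝ} {q : E → E} (hq : HasQuadSupport g q 0)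
    (hg : Continuous g) (z : E) : ∃ x, ∀ y, g x + inner ℝ (z - x) (y - x) ≤ g y := by
  have hcont : Continuous fun x => g x + ‖x‖ ^ 2 / 2 - inner ℝ z x := by fun_prop
  have hlim : Tendsto (fun x => g x + ‖x‖ ^ 2 / 2 - inner ℝ z x) (cocompact E) atTop := by
    have h1 : Tendsto (fun t : ℝ => t * (t / 2 - ‖q 0 - z‖)) atTop atTop := by
      refine tendsto_id.atTop_mul_atTop₀ ?_
      exact tendsto_atTop_add_const_right _ (-‖q 0 - z‖) (tendsto_id.atTop_div_const two_pos)
    have h2 := tendsto_atTop_add_const_left _ (g 0) (h1.comp (tendsto_norm_cocompact_atTop (E := E)))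
    refine tendsto_atTop_mono (fun x => ?_) h2
    have h3 := hq 0 x
    have h4 := neg_le_of_abs_le (abs_real_inner_le_norm (q 0 - z) x)
    simp only [Function.comp, sub_zero, inner_sub_left] at h3 h4 ⊢
    nlinarith
  obtain ⟨x, hx⟩ := hcont.exists_forall_le hlim
  refine ⟨x, fun y => ?_⟩
  -- Compare the minimiser $x$ with the point $w$ of the segment towards $y$; the supports at $w$
  -- yield the convexity inequality `e5`. Dividing by $t$ and letting $t\to0$ makes $z-x$ a
  -- subgradient at $x$.
  have key : ∀ t : ℝ, 0 < t → t ≤ 1 →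
      g x + inner ℝ (z - x) (y - x) ≤ g y + t * (‖y - x‖ ^ 2 / 2) := by
    intro t h0 h1
    set w := x + t • (y - x) with hw
    have a1 := hq w x
    have a2 := hq w y
    have e1 : x - w = (-t) • (y - x) := by rw [hw]; module
    have e2 : y - w = (1 - t) • (y - x) := by rw [hw]; module
    rw [e1, real_inner_smul_right] at a1
    rw [e2, real_inner_smul_right] at a2
    have a3 := hx w
    have e3 : ‖w‖ ^ 2 = ‖x‖ ^ 2 + 2 * (t * inner ℝ x (y - x)) + t ^ 2 * ‖y - x‖ ^ 2 := by
      rw [hw, norm_add_sq_real, real_inner_smul_right, norm_smul, mul_pow, Real.norm_eq_abs,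
        sq_abs]
    have e4 : inner ℝ z w = inner ℝ z x + t * inner ℝ z (y - x) := by
      rw [hw, inner_add_right, real_inner_smul_right]
    rw [e3, e4] at a3
    have e5 : g w ≤ (1 - t) * g x + t * g y := by
      have b1 := mul_le_mul_of_nonneg_left a1 (sub_nonneg.2 h1)
      have b2 := mul_le_mul_of_nonneg_left a2 h0.le
      nlinarith
    rw [inner_sub_left]
    have : t * (g x + (inner ℝ z (y - x) - inner ℝ x (y - x)))
        ≤ t * (g y + t * (‖y - x‖ ^ 2 / 2)) := by nlinarith
    exact le_of_mul_le_mul_left this h0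
  have lim : Tendsto (fun t : ℝ => g y + t * (‖y - x‖ ^ 2 / 2)) (𝓝[>] 0)
      (𝓝 (g y + 0 * (‖y - x‖ ^ 2 / 2))) :=
    tendsto_nhdsWithin_of_tendsto_nhds ((tendsto_id.mul_const _).const_add _)
  rw [zero_mul, add_zero] at lim
  refine ge_of_tendsto lim ?_
  filter_upwards [Ioc_mem_nhdsGT (zero_lt_one' ℝ)] with t ht using key t ht.1 ht.2

variable [MeasurableSpace E] [BorelSpace E] (μ : Measure E) [μ.IsAddHaarMeasure]

theorem LipschitzWith.addHaar_image_eq_zero {K : NNReal} {f : E → E} (hf : LipschitzWith K f)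
    {s : Set E} (hs : μ s = 0) : μ (f '' s) = 0 := by
  have a1 : (μH[Module.finrank ℝ E] : Measure E) ≪ μ := Measure.absolutelyContinuous_isAddHaarMeasure _ _
  have a2 : μ ≪ (μH[Module.finrank ℝ E] : Measure E) := Measure.absolutelyContinuous_isAddHaarMeasure _ _
  apply a2
  have h := hf.hausdorffMeasure_image_le (d := Module.finrank ℝ E) (by positivity) s
  rw [a1 hs, mul_zero] at h
  exact le_antisymm h bot_le

/-- **Alexandrov's theorem**, for functions with subgradients everywhere. -/
theorem HasQuadSupport.ae_hasFDerivAt {g : E → ℝ} {q : E → E} (hq : HasQuadSupport g q 0)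
    (hg : Continuous g) : ∀ᵐ x ∂μ, ∃ B : E →L[ℝ] E, HasFDerivAt q B x := by
  -- $P$ is the resolvent $(I+\partial g)^{-1}$: firmly nonexpansive, hence 1-Lipschitz, with
  -- $y\mapsto y+q(y)$ as a right inverse.
  choose P hP using hq.exists_prox hg
  have mono : ∀ z w, ‖P z - P w‖ ^ 2 ≤ inner ℝ (z - w) (P z - P w) := by
    intro z w
    have h1 := hP z (P w)
    have h2 := hP w (P z)
    have e : inner ℝ (z - P z) (P w - P z) = - inner ℝ (z - P z) (P z - P w) := by
      rw [← inner_neg_right, neg_sub]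
    have : inner ℝ (z - w) (P z - P w) - ‖P z - P w‖ ^ 2
        = inner ℝ (z - P z) (P z - P w) - inner ℝ (w - P w) (P z - P w) := by
      rw [← real_inner_self_eq_norm_sq, ← inner_sub_left, ← inner_sub_left]
      congr 1; abel
    linarith
  have lip : LipschitzWith 1 P := by
    refine LipschitzWith.of_dist_le_mul fun z w => ?_
    rw [dist_eq_norm, dist_eq_norm, NNReal.coe_one, one_mul]
    have h1 := (mono z w).trans (real_inner_le_norm _ _)
    by_contra! hlt
    have h2 : 0 < ‖P z - P w‖ := (norm_nonneg _).trans_lt hlt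
    nlinarith
  have inv : ∀ x, P (x + q x) = x := by
    intro x
    have h1 := hP (x + q x) x
    have h2 := hq x (P (x + q x))
    set y := P (x + q x)
    have e : inner ℝ (x + q x - y) (x - y) = ‖y - x‖ ^ 2 - inner ℝ (q x) (y - x) := by
      have : x + q x - y = (-(y - x)) + q x := by abel
      rw [this, ← neg_sub y x, inner_neg_right, inner_add_left, inner_neg_left,
        real_inner_self_eq_norm_sq]
      ring
    rw [e] at h1
    have h3 : ‖y - x‖ ^ 2 ≤ 0 := by linarith
    have h4 : ‖y - x‖ = 0 := by nlinarith [norm_nonneg (y - x)]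
    exact sub_eq_zero.1 (norm_eq_zero.1 h4)
  -- Every $x$ equals $P(x+q(x))$, so it suffices to discard two null images: of the points where
  -- $P$ is not differentiable (Rademacher) and of its critical points (Sard).
  have null1 : μ (P '' {z | ¬ DifferentiableAt ℝ P z}) = 0 :=
    lip.addHaar_image_eq_zero μ (ae_iff.1 lip.ae_differentiableAt)
  have null2 : μ (P '' {z | DifferentiableAt ℝ P z ∧ (fderiv ℝ P z).det = 0}) = 0 :=
    addHaar_image_eq_zero_of_det_fderivWithin_eq_zero μ
      (fun z hz => hz.1.hasFDerivAt.hasFDerivWithinAt) (fun z hz => hz.2)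
  filter_upwards [measure_eq_zero_iff_ae_notMem.1 null1, measure_eq_zero_iff_ae_notMem.1 null2] with x h1 h2
  have hd : DifferentiableAt ℝ P (x + q x) := by
    by_contra hc
    exact h1 ⟨x + q x, hc, inv x⟩
  have hdet : (fderiv ℝ P (x + q x)).det ≠ 0 := fun hc => h2 ⟨x + q x, ⟨hd, hc⟩, inv x⟩
  set A := (fderiv ℝ P (x + q x)).toContinuousLinearEquivOfDetNeZero hdet
  have hA : HasFDerivAt P (A : E →L[ℝ] E) (x + q x) := hd.hasFDerivAt
  -- Differentiating the right inverse requires its continuity at $x$: points away from $x+q(x)$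
  -- must not be mapped by $P$ close to $x$.
  have hZ : ContinuousAt (fun y => y + q y) x := by
    obtain ⟨c, hc, hAc⟩ : ∃ c > 0, ∀ v, c * ‖v‖ ≤ ‖A v‖ := by
      refine ⟨(‖(A.symm : E →L[ℝ] E)‖ + 1)⁻¹, by positivity, fun v => ?_⟩
      rw [inv_mul_le_iff₀ (by positivity)]
      have := (A.symm : E →L[ℝ] E).le_opNorm (A v)
      simp only [ContinuousLinearEquiv.coe_coe, ContinuousLinearEquiv.symm_apply_apply] at this
      nlinarith [norm_nonneg (A v)]
    have hlo := hA
    rw [hasFDerivAt_iff_isLittleO_nhds_zero, isLittleO_iff] at hlo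
    obtain ⟨r, hr, hball⟩ := Metric.eventually_nhds_iff_ball.1 (hlo (half_pos hc))
    have near : ∀ v : E, ‖v‖ < r → c / 2 * ‖v‖ ≤ ‖P (x + q x + v) - x‖ := by
      intro v hv
      have b1 := hball v (by rwa [mem_ball_zero_iff])
      rw [inv] at b1
      have b2 := hAc v
      have b3 := norm_sub_norm_le (A v) (P (x + q x + v) - x)
      rw [← norm_neg (A v - _), neg_sub] at b3
      simp only [ContinuousLinearEquiv.coe_coe] at b1
      linarith
    -- Monotonicity of $P$ makes $\langle e,P\rangle$ nondecreasing along the ray in direction $e$,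
    -- so the separation gained at radius $s$ from `near` persists at larger radii.
    have far : ∀ (v : E) (s : ℝ), 0 < s → s < r → s ≤ ‖v‖ →
        (c / 2) ^ 2 * s ≤ ‖P (x + q x + v) - x‖ := by
      intro v s hs hsr hsv
      have hv : 0 < ‖v‖ := hs.trans_le hsv
      set e := (1 / ‖v‖) • v with he
      have hen : ‖e‖ = 1 := by rw [he, norm_smul, norm_div, norm_one, norm_norm]; field_simp
      have c1 := near (s • e) (by rw [norm_smul, hen, Real.norm_of_nonneg hs.le, mul_one]; exact hsr)
      rw [norm_smul, hen, Real.norm_of_nonneg hs.le, mul_one] at c1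
      have c2 := mono (x + q x + s • e) (x + q x)
      rw [inv, add_sub_cancel_left, real_inner_smul_left] at c2
      have c3 : inner ℝ e (P (x + q x + s • e) - x) ≤ inner ℝ e (P (x + q x + v) - x) := by
        rcases hsv.eq_or_lt with heq | hlt
        · have : s • e = v := by rw [he, heq, smul_smul, mul_one_div_cancel hv.ne', one_smul]
          rw [this]
        · have d := mono (x + q x + v) (x + q x + s • e)
          have e1 : x + q x + v - (x + q x + s • e) = (‖v‖ - s) • e := by
            have : v = ‖v‖ • e := by rw [he, smul_smul, mul_one_div_cancel hv.ne', one_smul]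
            rw [sub_smul, ← this]; abel
          rw [e1, real_inner_smul_left] at d
          have d2 : 0 ≤ inner ℝ e (P (x + q x + v) - P (x + q x + s • e)) := by
            by_contra! hneg
            nlinarith [sq_nonneg ‖P (x + q x + v) - P (x + q x + s • e)‖]
          rw [inner_sub_right] at d2 ⊢
          rw [inner_sub_right]
          linarith
      have c4 := real_inner_le_norm e (P (x + q x + v) - x)
      rw [hen, one_mul] at c4
      have c5 : (c / 2 * s) ^ 2 ≤ s * ‖P (x + q x + v) - x‖ := by
        calc (c / 2 * s) ^ 2 ≤ ‖P (x + q x + s • e) - x‖ ^ 2 := by gcongr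
          _ ≤ _ := c2
          _ ≤ _ := by gcongr; exact c3.trans c4
      have : s * ((c / 2) ^ 2 * s) ≤ s * ‖P (x + q x + v) - x‖ := by nlinarith
      exact le_of_mul_le_mul_left this hs
    rw [Metric.continuousAt_iff]
    intro ε hε
    have hs : 0 < min ε (r / 2) := by positivity
    refine ⟨(c / 2) ^ 2 * min ε (r / 2), by positivity, fun {y} hy => ?_⟩
    by_contra! hcon
    have := far (y + q y - (x + q x)) (min ε (r / 2)) hs ((min_le_right _ _).trans_lt (by linarith))
      ((min_le_left _ _).trans (by rwa [dist_eq_norm] at hcon))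
    rw [add_sub_cancel, inv, ← dist_eq_norm] at this
    linarith
  have hder := HasFDerivAt.of_local_left_inverse hZ hA (Eventually.of_forall inv)
  refine ⟨A.symm - ContinuousLinearMap.id ℝ E, ?_⟩
  have := hder.sub (hasFDerivAt_id (𝕜 := ℝ) x)
  convert this using 1
  ext y; simp

/-- **Alexandrov's theorem**, for functions with quadratic supports everywhere. -/
theorem HasQuadSupport.ae_expansion {f : E → ℝ} {q : E → E} {lam : ℝ}
    (hq : HasQuadSupport f q lam) (hf : Continuous f) :
    ∀ᵐ x ∂μ, ∃ B : E →L[ℝ] E,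
      (fun h => f (x + h) - f x - inner ℝ (q x) h - 1 / 2 * inner ℝ (B h) h)
        =o[𝓝 0] fun h => ‖h‖ ^ 2 := by
  filter_upwards [hq.add_sq.ae_hasFDerivAt μ (by fun_prop)] with x ⟨B, hB⟩
  refine ⟨B - lam • ContinuousLinearMap.id ℝ E, ?_⟩
  have := hq.add_sq.expansion_of_hasFDerivAt hB
  refine this.congr_left fun h => ?_
  simp only [inner_add_left, real_inner_smul_left, sub_apply,
    smul_apply, ContinuousLinearMap.id_apply, inner_sub_left,
    real_inner_self_eq_norm_sq, norm_add_sq_real]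
  ring

end Alexandrov

/-! ### Second order jets, Taylor expansions and difference quotients. -/

section Jets

open MeasureTheory Asymptotics

variable {n : ℕ}

/-- The quadratic form `h ↦ ⟨Ah, h⟩` of a symmetric matrix. -/
noncomputable def matQuad (A : symMat n) (h : EuclideanSpace ℝ (Fin n)) : ℝ :=
  inner ℝ (Matrix.toEuclideanCLM (𝕜 := ℝ) (A : Matrix (Fin n) (Fin n) ℝ) h) h

/-- The quadratic polynomial `h ↦ r + ⟨p, h⟩ + ⟨Ah, h⟩ / 2` with 2-jet `(r, p, A)` at `0`. -/
noncomputable def jetPoly (J : Jet n) (h : EuclideanSpace ℝ (Fin n)) : ℝ :=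
  J.1 + inner ℝ J.2.1 h + 1 / 2 * matQuad J.2.2 h

theorem matQuad_eq_dotProduct (A : symMat n) (h : EuclideanSpace ℝ (Fin n)) :
    matQuad A h = h.ofLp ⬝ᵥ ((A : Matrix (Fin n) (Fin n) ℝ).mulVec h.ofLp) := by
  simp [matQuad, EuclideanSpace.inner_eq_star_dotProduct]

theorem matQuad_add (A B : symMat n) (h : EuclideanSpace ℝ (Fin n)) :
    matQuad (A + B) h = matQuad A h + matQuad B h := by
  simp [matQuad, inner_add_left]

theorem matQuad_sub (A B : symMat n) (h : EuclideanSpace ℝ (Fin n)) :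
    matQuad (A - B) h = matQuad A h - matQuad B h := by
  simp [matQuad, inner_sub_left]

theorem matQuad_const_smul (t : ℝ) (A : symMat n) (h : EuclideanSpace ℝ (Fin n)) :
    matQuad (t • A) h = t * matQuad A h := by
  simp [matQuad, real_inner_smul_left]

theorem matQuad_smul (A : symMat n) (t : ℝ) (h : EuclideanSpace ℝ (Fin n)) :
    matQuad A (t • h) = t ^ 2 * matQuad A h := by
  simp only [matQuad, map_smul, real_inner_smul_left, real_inner_smul_right]
  ring

@[simp] theorem matQuad_neg (A : symMat n) (h : EuclideanSpace ℝ (Fin n)) :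
    matQuad A (-h) = matQuad A h := by
  simp [matQuad]

@[simp] theorem matQuad_zero (A : symMat n) : matQuad A 0 = 0 := by
  simp [matQuad]

theorem jetPoly_zero (J : Jet n) : jetPoly J 0 = J.1 := by simp [jetPoly]

/-- The identity matrix as a symmetric matrix. -/
def symOne (n : ℕ) : symMat n := ⟨1, Matrix.isSymm_one⟩

theorem matQuad_symOne (h : EuclideanSpace ℝ (Fin n)) : matQuad (symOne n) h = ‖h‖ ^ 2 := by
  simp [matQuad, symOne]

theorem inner_toEuclideanCLM_comm (A : symMat n) (h k : EuclideanSpace ℝ (Fin n)) :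
    inner ℝ (Matrix.toEuclideanCLM (𝕜 := ℝ) (A : Matrix (Fin n) (Fin n) ℝ) h) k
      = inner ℝ (Matrix.toEuclideanCLM (𝕜 := ℝ) (A : Matrix (Fin n) (Fin n) ℝ) k) h := by
  have hA : (A : Matrix (Fin n) (Fin n) ℝ).transpose = A := A.2
  simp only [EuclideanSpace.inner_eq_star_dotProduct, star_trivial, Matrix.ofLp_toEuclideanCLM]
  rw [Matrix.dotProduct_mulVec, ← Matrix.mulVec_transpose, hA, dotProduct_comm]

theorem mem_psd_iff (A : symMat n) : A ∈ psd n ↔ ∀ h, 0 ≤ matQuad A h := by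
  constructor
  · intro hA h
    rw [matQuad_eq_dotProduct]
    simpa using hA.dotProduct_mulVec_nonneg h.ofLp
  · intro hA
    refine Matrix.PosSemidef.of_dotProduct_mulVec_nonneg ?_ fun v => ?_
    · have hs : (A : Matrix (Fin n) (Fin n) ℝ).transpose = A := A.2
      rw [Matrix.IsHermitian, Matrix.conjTranspose_eq_transpose_of_trivial, hs]
    · have := hA (WithLp.toLp 2 v)
      rw [matQuad_eq_dotProduct] at this
      simpa using this

/-- The derivative supplied by Alexandrov's theorem is not known to be symmetric, but an expansion
sees only its quadratic form, so it may be symmetrised. -/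
theorem exists_symMat_matQuad_eq (B : EuclideanSpace ℝ (Fin n) →L[ℝ] EuclideanSpace ℝ (Fin n)) :
    ∃ A : symMat n, ∀ h, matQuad A h = inner ℝ (B h) h := by
  set M := (Matrix.toEuclideanCLM (n := Fin n) (𝕜 := ℝ)).symm B with hM
  have hB : B = Matrix.toEuclideanCLM (n := Fin n) (𝕜 := ℝ) M := by simp [hM]
  refine ⟨⟨(1 / 2 : ℝ) • (M + M.transpose), ?_⟩, fun h => ?_⟩
  · change (_ : Matrix (Fin n) (Fin n) ℝ).transpose = _
    rw [Matrix.transpose_smul, Matrix.transpose_add, Matrix.transpose_transpose, add_comm]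
  · rw [matQuad_eq_dotProduct, hB, EuclideanSpace.inner_eq_star_dotProduct]
    simp only [star_trivial, Matrix.ofLp_toEuclideanCLM, Matrix.smul_mulVec, Matrix.add_mulVec,
      dotProduct_smul, dotProduct_add, Matrix.mulVec_transpose, smul_eq_mul]
    rw [dotProduct_comm h.ofLp (Matrix.vecMul _ _), ← Matrix.dotProduct_mulVec]
    ring

/-- Turns $\operatorname{tr}(EA)$ into a sum of pure second derivatives. Their symmetric second
differences are bounded below for semiconvex functions. -/
theorem trace_mul_eq_sum_matQuad {m : ℕ} (e : Fin m → EuclideanSpace ℝ (Fin n)) (E A : symMat n)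
    (hE : (E : Matrix (Fin n) (Fin n) ℝ) = ∑ i, Matrix.vecMulVec (e i).ofLp (e i).ofLp) :
    Matrix.trace ((E : Matrix (Fin n) (Fin n) ℝ) * (A : Matrix (Fin n) (Fin n) ℝ))
      = ∑ i, matQuad A (e i) := by
  rw [hE, Finset.sum_mul, Matrix.trace_sum]
  refine Finset.sum_congr rfl fun i _ => ?_
  rw [matQuad_eq_dotProduct, Matrix.vecMulVec_mul, Matrix.trace_vecMulVec,
    Matrix.dotProduct_mulVec, dotProduct_comm]

theorem exists_eq_sum_vecMulVec {E : symMat n} (hE : E ∈ psd n) :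
    ∃ (m : ℕ) (e : Fin m → EuclideanSpace ℝ (Fin n)),
      (E : Matrix (Fin n) (Fin n) ℝ) = ∑ i, Matrix.vecMulVec (e i).ofLp (e i).ofLp := by
  obtain ⟨m, v, hv⟩ := Matrix.posSemidef_iff_eq_sum_vecMulVec.1 hE
  exact ⟨m, fun i => WithLp.toLp 2 (v i), by simpa using hv⟩

/-- `f` has the second order expansion with jet `J` at `x`. -/
def HasJetExpansion (f : EuclideanSpace ℝ (Fin n) → ℝ) (x : EuclideanSpace ℝ (Fin n))
    (J : Jet n) : Prop :=
  (fun h => f (x + h) - jetPoly J h) =o[𝓝 0] fun h => ‖h‖ ^ 2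

theorem HasJetExpansion.apply_eq {f : EuclideanSpace ℝ (Fin n) → ℝ}
    {x : EuclideanSpace ℝ (Fin n)} {J : Jet n} (h : HasJetExpansion f x J) : f x = J.1 := by
  have := (isLittleO_iff.1 h zero_lt_one).self_of_nhds
  simpa [jetPoly_zero, sub_eq_zero] using this

theorem HasJetExpansion.tendsto_remainder {f : EuclideanSpace ℝ (Fin n) → ℝ}
    {x : EuclideanSpace ℝ (Fin n)} {J : Jet n} (h : HasJetExpansion f x J)
    (v : EuclideanSpace ℝ (Fin n)) :
    Tendsto (fun t : ℝ => (f (x + t • v) - jetPoly J (t • v)) / t ^ 2) (𝓝[>] 0) (𝓝 0) := by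
  have h1 : Tendsto (fun t : ℝ => t • v) (𝓝[>] 0) (𝓝 0) := by
    have : Tendsto (fun t : ℝ => t • v) (𝓝 0) (𝓝 ((0 : ℝ) • v)) := tendsto_id.smul_const v
    rw [zero_smul] at this
    exact tendsto_nhdsWithin_of_tendsto_nhds this
  have h2 := h.comp_tendsto h1
  refine (h2.trans_isBigO ?_).tendsto_div_nhds_zero
  refine IsBigO.of_bound (‖v‖ ^ 2) (Eventually.of_forall fun t => ?_)
  simp only [Function.comp, norm_smul, mul_pow, norm_pow]
  rw [norm_mul, norm_pow, norm_norm, norm_pow, norm_norm, mul_comm]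

theorem HasJetExpansion.tendsto_first_difference {f : EuclideanSpace ℝ (Fin n) → ℝ}
    {x : EuclideanSpace ℝ (Fin n)} {J : Jet n} (h : HasJetExpansion f x J)
    (v : EuclideanSpace ℝ (Fin n)) :
    Tendsto (fun t : ℝ => (f (x + t • v) - f x) / t) (𝓝[>] 0) (𝓝 (inner ℝ J.2.1 v)) := by
  have ht : Tendsto (fun t : ℝ => t) (𝓝[>] 0) (𝓝 0) :=
    tendsto_nhdsWithin_of_tendsto_nhds tendsto_id
  have h1 := ((h.tendsto_remainder v).add_const (1 / 2 * matQuad J.2.2 v)).mul ht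
  rw [mul_zero] at h1
  have h2 := h1.const_add (inner ℝ J.2.1 v)
  rw [add_zero] at h2
  refine h2.congr' ?_
  filter_upwards [self_mem_nhdsWithin] with t ht
  have : t ≠ 0 := ne_of_gt ht
  rw [h.apply_eq, jetPoly, matQuad_smul, real_inner_smul_right]
  field_simp
  ring

theorem HasJetExpansion.tendsto_second_difference {f : EuclideanSpace ℝ (Fin n) → ℝ}
    {x : EuclideanSpace ℝ (Fin n)} {J : Jet n} (h : HasJetExpansion f x J)
    (v : EuclideanSpace ℝ (Fin n)) :
    Tendsto (fun t : ℝ => (f (x + t • v) + f (x + t • (-v)) - 2 * f x) / t ^ 2) (𝓝[>] 0)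
      (𝓝 (matQuad J.2.2 v)) := by
  have h1 := ((h.tendsto_remainder v).add (h.tendsto_remainder (-v))).add_const (matQuad J.2.2 v)
  rw [add_zero, zero_add] at h1
  refine h1.congr' ?_
  filter_upwards [self_mem_nhdsWithin] with t ht
  have : t ≠ 0 := ne_of_gt ht
  rw [h.apply_eq, jetPoly, jetPoly, matQuad_smul, matQuad_smul, real_inner_smul_right,
    real_inner_smul_right, matQuad_neg, inner_neg_right]
  field_simp
  ring

/-- A finite difference approximation of the operator
`φ ↦ a φ + ⟨b, Dφ⟩ + ∑ i, ⟨D²φ (e i), e i⟩`. -/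
noncomputable def diffOp {m : ℕ} (a : ℝ) (b : EuclideanSpace ℝ (Fin n))
    (e : Fin m → EuclideanSpace ℝ (Fin n)) (t : ℝ)
    (f : EuclideanSpace ℝ (Fin n) → ℝ) (x : EuclideanSpace ℝ (Fin n)) : ℝ :=
  ∑ i, (f (x + t • e i) + f (x + t • (-e i)) - 2 * f x) / t ^ 2
    + (f (x + t • b) - f x) / t + a * f x

theorem HasJetExpansion.tendsto_diffOp {f : EuclideanSpace ℝ (Fin n) → ℝ}
    {x : EuclideanSpace ℝ (Fin n)} {J K : Jet n} (h : HasJetExpansion f x J)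
    {m : ℕ} {e : Fin m → EuclideanSpace ℝ (Fin n)}
    (hK : (K.2.2 : Matrix (Fin n) (Fin n) ℝ) = ∑ i, Matrix.vecMulVec (e i).ofLp (e i).ofLp) :
    Tendsto (fun t : ℝ => diffOp K.1 K.2.1 e t f x) (𝓝[>] 0) (𝓝 (jetInner K J)) := by
  unfold diffOp jetInner
  rw [trace_mul_eq_sum_matQuad e _ _ hK, real_inner_comm, ← h.apply_eq]
  exact ((tendsto_finsetSum _ fun i _ => h.tendsto_second_difference (e i)).add
    (h.tendsto_first_difference _)).add_const _

/-! ### Two-jets of smooth functions -/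

theorem hasFDerivAt_jetPoly (J : Jet n) (h : EuclideanSpace ℝ (Fin n)) :
    HasFDerivAt (jetPoly J) (innerSL ℝ (J.2.1 +
      Matrix.toEuclideanCLM (𝕜 := ℝ) (J.2.2 : Matrix (Fin n) (Fin n) ℝ) h)) h := by
  set T := Matrix.toEuclideanCLM (𝕜 := ℝ) (J.2.2 : Matrix (Fin n) (Fin n) ℝ) with hT
  have h1 := ((T.hasFDerivAt (x := h)).inner ℝ (hasFDerivAt_id (𝕜 := ℝ) h)).const_mul (1 / 2)
  have h2 := ((innerSL ℝ J.2.1).hasFDerivAt (x := h)).const_add J.1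
  refine (h2.add h1).congr_fderiv ?_
  ext k
  have : inner ℝ (T h) k = inner ℝ (T k) h := inner_toEuclideanCLM_comm _ _ _
  simp [this]
  ring

/-- The derivative of the gradient of `jetPoly`. -/
noncomputable def hessCLM (A : symMat n) :
    EuclideanSpace ℝ (Fin n) →L[ℝ] EuclideanSpace ℝ (Fin n) →L[ℝ] ℝ :=
  LinearMap.toContinuousLinearMap
    { toFun := fun h => innerSL ℝ (Matrix.toEuclideanCLM (𝕜 := ℝ) (A : Matrix (Fin n) (Fin n) ℝ) h)
      map_add' := fun h k => by simp
      map_smul' := fun t h => by simp }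

theorem hessCLM_apply (A : symMat n) (h k : EuclideanSpace ℝ (Fin n)) : hessCLM A h k =
    inner ℝ (Matrix.toEuclideanCLM (𝕜 := ℝ) (A : Matrix (Fin n) (Fin n) ℝ) h) k := rfl

theorem hessCLM_single (A : symMat n) (i j : Fin n) :
    hessCLM A (EuclideanSpace.single i 1) (EuclideanSpace.single j 1)
      = (A : Matrix (Fin n) (Fin n) ℝ) i j := by
  have hA : (A : Matrix (Fin n) (Fin n) ℝ).transpose = A := A.2
  rw [hessCLM_apply, EuclideanSpace.inner_eq_star_dotProduct]
  conv_rhs => rw [← hA]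
  simp

theorem isTwoJet_jetPoly (J : Jet n) (x : EuclideanSpace ℝ (Fin n)) :
    IsTwoJet (fun y => jetPoly J (y - x)) x J := by
  have hd : ∀ y, HasFDerivAt (fun y => jetPoly J (y - x)) (innerSL ℝ (J.2.1 +
      Matrix.toEuclideanCLM (𝕜 := ℝ) (J.2.2 : Matrix (Fin n) (Fin n) ℝ) (y - x))) y := by
    intro y
    have := (hasFDerivAt_jetPoly J (y - x)).comp y ((hasFDerivAt_id (𝕜 := ℝ) y).sub_const x)
    simpa [Function.comp_def] using this
  have hfd : fderiv ℝ (fun y => jetPoly J (y - x))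
      = fun y => innerSL ℝ J.2.1 + hessCLM J.2.2 (y - x) := by
    funext y
    rw [(hd y).fderiv, map_add]
    rfl
  refine ⟨?_, by simp [jetPoly_zero], ?_, ?_⟩
  · unfold jetPoly matQuad
    apply ContDiff.contDiffAt
    have hT := (Matrix.toEuclideanCLM (𝕜 := ℝ)
      (J.2.2 : Matrix (Fin n) (Fin n) ℝ)).contDiff (n := 2)
    have h0 : ContDiff ℝ 2 (fun y : EuclideanSpace ℝ (Fin n) => y - x) :=
      contDiff_id.sub contDiff_const
    exact (contDiff_const.add (contDiff_const.inner ℝ h0)).add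
      (contDiff_const.mul ((hT.comp h0).inner ℝ h0))
  · rw [gradient, (hd x).fderiv]
    simp
    exact (LinearIsometryEquiv.symm_apply_apply (InnerProductSpace.toDual ℝ _) J.2.1).symm
  · ext i j
    have hh : HasFDerivAt (fun y => innerSL ℝ J.2.1 + hessCLM J.2.2 (y - x)) (hessCLM J.2.2) x := by
      have := (hessCLM J.2.2).hasFDerivAt.comp x (f := fun y => y - x)
        ((hasFDerivAt_id (𝕜 := ℝ) x).sub_const x)
      simpa [Function.comp_def] using this.const_add (innerSL ℝ J.2.1)
    rw [hessianMatrix, Matrix.of_apply, hfd, hh.fderiv, hessCLM_single]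

theorem IsTwoJet.add {φ ψ : EuclideanSpace ℝ (Fin n) → ℝ} {x : EuclideanSpace ℝ (Fin n)}
    {J K : Jet n} (hφ : IsTwoJet φ x J) (hψ : IsTwoJet ψ x K) : IsTwoJet (φ + ψ) x (J + K) := by
  obtain ⟨c1, r1, p1, A1⟩ := hφ
  obtain ⟨c2, r2, p2, A2⟩ := hψ
  have d1 := c1.differentiableAt two_ne_zero
  have d2 := c2.differentiableAt two_ne_zero
  refine ⟨c1.add c2, by simp [r1, r2], ?_, ?_⟩
  · change J.2.1 + K.2.1 = _
    rw [p1, p2, gradient, gradient, gradient, fderiv_add d1 d2, map_add]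
  · change (J.2.2 : Matrix (Fin n) (Fin n) ℝ) + (K.2.2 : Matrix (Fin n) (Fin n) ℝ) = _
    rw [A1, A2]
    have e1 : fderiv ℝ (φ + ψ) =ᶠ[𝓝 x] fderiv ℝ φ + fderiv ℝ ψ := by
      filter_upwards [c1.eventually (by simp), c2.eventually (by simp)] with y h1 h2
      exact fderiv_add (h1.differentiableAt two_ne_zero) (h2.differentiableAt two_ne_zero)
    have f1 : DifferentiableAt ℝ (fderiv ℝ φ) x :=
      (c1.fderiv_right (m := 1) (by norm_num)).differentiableAt one_ne_zero
    have f2 : DifferentiableAt ℝ (fderiv ℝ ψ) x :=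
      (c2.fderiv_right (m := 1) (by norm_num)).differentiableAt one_ne_zero
    ext i j
    simp only [hessianMatrix, Matrix.add_apply, Matrix.of_apply]
    rw [e1.fderiv_eq, fderiv_add f1 f2]
    simp

theorem exists_isTwoJet {φ : EuclideanSpace ℝ (Fin n) → ℝ} {x : EuclideanSpace ℝ (Fin n)}
    (h : ContDiffAt ℝ 2 φ x) : ∃ J, IsTwoJet φ x J := by
  refine ⟨(φ x, gradient φ x, ⟨hessianMatrix φ x, ?_⟩), h, rfl, rfl, rfl⟩
  have hs := h.isSymmSndFDerivAt (by simp)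
  change (hessianMatrix φ x).transpose = hessianMatrix φ x
  ext i j
  simp only [hessianMatrix, Matrix.transpose_apply, Matrix.of_apply]
  exact hs _ _

/-- Second order Taylor expansion. -/
theorem IsTwoJet.hasJetExpansion {φ : EuclideanSpace ℝ (Fin n) → ℝ}
    {x : EuclideanSpace ℝ (Fin n)} {J : Jet n} (h : IsTwoJet φ x J) : HasJetExpansion φ x J := by
  obtain ⟨c, hr, hp, hA⟩ := h
  have f1 : DifferentiableAt ℝ (fderiv ℝ φ) x :=
    (c.fderiv_right (m := 1) (by norm_num)).differentiableAt one_ne_zero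
  have hess : fderiv ℝ (fderiv ℝ φ) x = hessCLM J.2.2 := by
    ext h k
    have e1 : h = ∑ i, h i • EuclideanSpace.single i (1 : ℝ) := by
      simpa using ((EuclideanSpace.basisFun (Fin n) ℝ).sum_repr h).symm
    have e2 : k = ∑ i, k i • EuclideanSpace.single i (1 : ℝ) := by
      simpa using ((EuclideanSpace.basisFun (Fin n) ℝ).sum_repr k).symm
    rw [e1, e2]
    simp only [map_sum, map_smul, sum_apply, smul_apply, hessCLM_single, hA, hessianMatrix,
      Matrix.of_apply]
  have grad : fderiv ℝ φ x = innerSL ℝ J.2.1 := by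
    rw [hp, gradient]
    exact (LinearIsometryEquiv.apply_symm_apply (InnerProductSpace.toDual ℝ _) (fderiv ℝ φ x)).symm
  have hd := f1.hasFDerivAt
  rw [hess, hasFDerivAt_iff_isLittleO_nhds_zero, isLittleO_iff] at hd
  rw [HasJetExpansion, isLittleO_iff]
  intro ε hε
  have hdiff : ∀ᶠ k in 𝓝 (0 : EuclideanSpace ℝ (Fin n)), DifferentiableAt ℝ φ (x + k) := by
    have : Tendsto (fun k : EuclideanSpace ℝ (Fin n) => x + k) (𝓝 0) (𝓝 x) := by
      simpa using (continuous_const_add x).tendsto 0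
    exact this.eventually ((c.eventually (by simp)).mono fun y hy => hy.differentiableAt two_ne_zero)
  obtain ⟨r, hr0, hball⟩ := Metric.eventually_nhds_iff_ball.1 ((hd hε).and hdiff)
  refine Metric.eventually_nhds_iff_ball.2 ⟨r, hr0, fun h hh => ?_⟩
  have hder : ∀ k ∈ Metric.closedBall (0 : EuclideanSpace ℝ (Fin n)) ‖h‖,
      HasFDerivWithinAt (fun k => φ (x + k) - jetPoly J k)
        (fderiv ℝ φ (x + k) - innerSL ℝ (J.2.1 +
          Matrix.toEuclideanCLM (𝕜 := ℝ) (J.2.2 : Matrix (Fin n) (Fin n) ℝ) k))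
        (Metric.closedBall 0 ‖h‖) k := by
    intro k hk
    have hk' : k ∈ Metric.ball (0 : EuclideanSpace ℝ (Fin n)) r := by
      rw [mem_ball_zero_iff] at hh ⊢
      rw [mem_closedBall_zero_iff] at hk
      exact hk.trans_lt hh
    have := (hball k hk').2.hasFDerivAt.comp k ((hasFDerivAt_id (𝕜 := ℝ) k).const_add x)
    exact ((by simpa [Function.comp_def] using this : HasFDerivAt (fun k => φ (x + k)) _ k).sub
      (hasFDerivAt_jetPoly J k)).hasFDerivWithinAt
  have hbound : ∀ k ∈ Metric.closedBall (0 : EuclideanSpace ℝ (Fin n)) ‖h‖,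
      ‖fderiv ℝ φ (x + k) - innerSL ℝ (J.2.1 +
          Matrix.toEuclideanCLM (𝕜 := ℝ) (J.2.2 : Matrix (Fin n) (Fin n) ℝ) k)‖ ≤ ε * ‖h‖ := by
    intro k hk
    rw [mem_closedBall_zero_iff] at hk
    have hk' : k ∈ Metric.ball (0 : EuclideanSpace ℝ (Fin n)) r := by
      rw [mem_ball_zero_iff] at hh ⊢
      exact hk.trans_lt hh
    have h1 := (hball k hk').1
    rw [grad] at h1
    have e : fderiv ℝ φ (x + k) - innerSL ℝ (J.2.1 +
          Matrix.toEuclideanCLM (𝕜 := ℝ) (J.2.2 : Matrix (Fin n) (Fin n) ℝ) k)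
        = fderiv ℝ φ (x + k) - innerSL ℝ J.2.1 - hessCLM J.2.2 k := by
      rw [map_add, sub_sub]; rfl
    rw [e]
    exact h1.trans (by gcongr)
  have main := (convex_closedBall _ _).norm_image_sub_le_of_norm_hasFDerivWithin_le hder hbound
    (Metric.mem_closedBall_self (norm_nonneg h)) (mem_closedBall_zero_iff.2 le_rfl)
  simp only [add_zero, jetPoly_zero, hr, sub_self, sub_zero] at main
  refine main.trans (le_of_eq ?_)
  rw [norm_pow, norm_norm]
  ring

end Jets

/-! ### Mollifying semiconvex subsolutions of linear equations. -/

section Mollification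

open MeasureTheory Asymptotics

variable {n : ℕ}

theorem jetInner_add_right (K J J' : Jet n) :
    jetInner K (J + J') = jetInner K J + jetInner K J' := by
  simp only [jetInner, Prod.fst_add, Prod.snd_add, Submodule.coe_add, Matrix.mul_add,
    Matrix.trace_add, inner_add_right]
  ring

theorem jetInner_smul_right (K : Jet n) (t : ℝ) (J : Jet n) :
    jetInner K (t • J) = t * jetInner K J := by
  simp only [jetInner, Prod.smul_fst, Prod.smul_snd, Submodule.coe_smul, Matrix.mul_smul,
    Matrix.trace_smul, real_inner_smul_right, smul_eq_mul]
  ring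

theorem jetPoly_add (J K : Jet n) (h : EuclideanSpace ℝ (Fin n)) :
    jetPoly (J + K) h = jetPoly J h + jetPoly K h := by
  simp only [jetPoly, Prod.fst_add, Prod.snd_add, inner_add_left, matQuad_add]
  ring

/-- `f` is a viscosity subsolution in `U` of the constraint `G`, tested by quadratic polynomials. -/
def IsQuadSubsolution (G : Set (Jet n)) (U : Set (EuclideanSpace ℝ (Fin n)))
    (f : EuclideanSpace ℝ (Fin n) → ℝ) : Prop :=
  ∀ x ∈ U, ∀ (p : EuclideanSpace ℝ (Fin n)) (A : symMat n),
    (∀ᶠ h in 𝓝 0, f (x + h) ≤ jetPoly (f x, p, A) h) → (f x, p, A) ∈ G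

/-- Adding $\delta|h|^2$ absorbs the remainder of the expansion and produces an upper test
polynomial; then $\delta\to0$. -/
theorem IsQuadSubsolution.le_of_hasJetExpansion {K : Jet n} {k : ℝ}
    {U : Set (EuclideanSpace ℝ (Fin n))} {f : EuclideanSpace ℝ (Fin n) → ℝ}
    (hf : IsQuadSubsolution {J | k ≤ jetInner K J} U f) {x : EuclideanSpace ℝ (Fin n)}
    (hx : x ∈ U) {J : Jet n} (hJ : HasJetExpansion f x J) : k ≤ jetInner K J := by
  have key : ∀ δ : ℝ, 0 < δ → k ≤ jetInner K J + δ * jetInner K (0, 0, (2 : ℝ) • symOne n) := by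
    intro δ hδ
    have e : J + δ • ((0, 0, (2 : ℝ) • symOne n) : Jet n)
        = (f x, J.2.1, J.2.2 + δ • (2 : ℝ) • symOne n) := by
      rw [hJ.apply_eq]
      simp [Prod.ext_iff]
    have := hf x hx J.2.1 (J.2.2 + δ • (2 : ℝ) • symOne n) (by
      filter_upwards [isLittleO_iff.1 hJ hδ] with h hh
      rw [← e, jetPoly_add]
      have h1 := (abs_le.1 hh).2
      rw [Real.norm_of_nonneg (by positivity)] at h1
      have h2 : jetPoly (δ • ((0, 0, (2 : ℝ) • symOne n) : Jet n)) h = δ * ‖h‖ ^ 2 := by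
        simp [jetPoly, matQuad_const_smul, matQuad_symOne]
        ring
      linarith)
    rw [← e, mem_ofPred_eq, jetInner_add_right, jetInner_smul_right] at this
    exact this
  have lim : Tendsto (fun δ : ℝ => jetInner K J + δ * jetInner K (0, 0, (2 : ℝ) • symOne n))
      (𝓝[>] 0) (𝓝 (jetInner K J + 0 * jetInner K (0, 0, (2 : ℝ) • symOne n))) :=
    tendsto_nhdsWithin_of_tendsto_nhds ((tendsto_id.mul_const _).const_add _)
  rw [zero_mul, add_zero] at lim
  exact ge_of_tendsto lim (by filter_upwards [self_mem_nhdsWithin] with δ hδ using key δ hδ)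

theorem HasQuadSupport.ae_hasJetExpansion {f : EuclideanSpace ℝ (Fin n) → ℝ}
    {q : EuclideanSpace ℝ (Fin n) → EuclideanSpace ℝ (Fin n)} {lam : ℝ}
    (hq : HasQuadSupport f q lam) (hf : Continuous f) :
    ∀ᵐ x, ∃ J, HasJetExpansion f x J := by
  filter_upwards [hq.ae_expansion volume hf] with x ⟨B, hB⟩
  obtain ⟨A, hA⟩ := exists_symMat_matQuad_eq B
  refine ⟨(f x, q x, A), hB.congr_left fun h => ?_⟩
  simp only [jetPoly, hA]
  ring

/-- The bound is uniform in $t\in(0,1]$ and $z$; it supplies the lower half of the domination when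
$t\to0$ under the integral. -/
theorem HasQuadSupport.le_diffOp {f : EuclideanSpace ℝ (Fin n) → ℝ}
    {q : EuclideanSpace ℝ (Fin n) → EuclideanSpace ℝ (Fin n)} {lam L B : ℝ}
    (hq : HasQuadSupport f q lam) (hlam : 0 ≤ lam) (hL : ∀ x, ‖q x‖ ≤ L) (hB : ∀ x, |f x| ≤ B)
    {m : ℕ} (a : ℝ) (b : EuclideanSpace ℝ (Fin n)) (e : Fin m → EuclideanSpace ℝ (Fin n))
    {t : ℝ} (ht : t ∈ Ioc (0 : ℝ) 1) (z : EuclideanSpace ℝ (Fin n)) :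
    -(∑ i, lam * ‖e i‖ ^ 2 + (L * ‖b‖ + lam / 2 * ‖b‖ ^ 2) + |a| * B) ≤ diffOp a b e t f z := by
  have ht0 := ht.1
  have low : ∀ v, f z + t * inner ℝ (q z) v - lam / 2 * (t ^ 2 * ‖v‖ ^ 2) ≤ f (z + t • v) := by
    intro v
    have := hq z (z + t • v)
    rwa [add_sub_cancel_left, real_inner_smul_right, norm_smul, mul_pow, Real.norm_eq_abs,
      sq_abs] at this
  have h1 : ∑ i, -(lam * ‖e i‖ ^ 2)
      ≤ ∑ i, (f (z + t • e i) + f (z + t • (-e i)) - 2 * f z) / t ^ 2 := by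
    refine Finset.sum_le_sum fun i _ => ?_
    rw [le_div_iff₀ (by positivity)]
    have a1 := low (e i)
    have a2 := low (-e i)
    rw [inner_neg_right, norm_neg] at a2
    linarith
  have h2 : -(L * ‖b‖ + lam / 2 * ‖b‖ ^ 2) ≤ (f (z + t • b) - f z) / t := by
    rw [le_div_iff₀ ht0]
    have a1 := low b
    have a2 := neg_le_of_abs_le (abs_real_inner_le_norm (q z) b)
    have a3 : ‖q z‖ * ‖b‖ ≤ L * ‖b‖ := by gcongr; exact hL z
    have a4 : t ^ 2 * (lam / 2 * ‖b‖ ^ 2) ≤ t * (lam / 2 * ‖b‖ ^ 2) := by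
      gcongr
      nlinarith [ht.2]
    have a5 : t * -(L * ‖b‖) ≤ t * inner ℝ (q z) b := by
      gcongr
      linarith
    linarith
  have h3 : -(|a| * B) ≤ a * f z := by
    have : |a * f z| ≤ |a| * B := by rw [abs_mul]; gcongr; exact hB z
    exact neg_le_of_abs_le this
  rw [Finset.sum_neg_distrib] at h1
  unfold diffOp
  linarith

open scoped Convolution

/-- Mollifying a viscosity subsolution of a linear equation with constant coefficients that has
quadratic supports gives a classical subsolution. -/
theorem IsQuadSubsolution.le_jetInner_mollification {f : EuclideanSpace ℝ (Fin n) → ℝ}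
    {q : EuclideanSpace ℝ (Fin n) → EuclideanSpace ℝ (Fin n)} {lam L B k : ℝ} {K : Jet n}
    {U : Set (EuclideanSpace ℝ (Fin n))}
    (hsub : IsQuadSubsolution {J | k ≤ jetInner K J} U f) (hK : K.2.2 ∈ psd n)
    (hq : HasQuadSupport f q lam) (hlam : 0 ≤ lam) (hL : ∀ x, ‖q x‖ ≤ L) (hB : ∀ x, |f x| ≤ B)
    (hf : Continuous f) (φ : ContDiffBump (0 : EuclideanSpace ℝ (Fin n)))
    {x : EuclideanSpace ℝ (Fin n)} (hx : Metric.ball x φ.rOut ⊆ U) {J : Jet n}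
    (hJ : IsTwoJet (φ.normed volume ⋆[ContinuousLinearMap.lsmul ℝ ℝ, volume] f) x J) :
    k ≤ jetInner K J := by
  obtain ⟨m, e, he⟩ := exists_eq_sum_vecMulVec hK
  set ρ := φ.normed (volume : Measure (EuclideanSpace ℝ (Fin n))) with hρ
  set v := (ρ ⋆[ContinuousLinearMap.lsmul ℝ ℝ, volume] f) with hv
  have ρcont : Continuous ρ := φ.continuous_normed
  have ρsupp : HasCompactSupport ρ := φ.hasCompactSupport_normed
  have ρint : ∫ t, ρ t = 1 := φ.integral_normed
  have ρnn : ∀ t, 0 ≤ ρ t := φ.nonneg_normed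
  have vdef : ∀ y, v y = ∫ t, ρ t * f (y - t) := fun y => by
    simp [hv, convolution_def]
  have integ : ∀ g : EuclideanSpace ℝ (Fin n) → ℝ, Continuous g →
      Integrable (fun t => ρ t * g t) := fun g hg =>
    (ρcont.mul hg).integrable_of_hasCompactSupport ρsupp.mul_right
  have Iy : ∀ y, Integrable (fun t => ρ t * f (y - t)) := fun y => integ _ (by fun_prop)
  -- Constant coefficients: the difference operator commutes with convolution.
  have diff_eq : ∀ s : ℝ, diffOp K.1 K.2.1 e s v x
      = ∫ t, ρ t * diffOp K.1 K.2.1 e s f (x - t) := by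
    intro s
    have e1 : ∀ t, ρ t * diffOp K.1 K.2.1 e s f (x - t)
        = ∑ i, (ρ t * f (x + s • e i - t) + ρ t * f (x + s • (-e i) - t)
            - 2 * (ρ t * f (x - t))) / s ^ 2
          + (ρ t * f (x + s • K.2.1 - t) - ρ t * f (x - t)) / s + K.1 * (ρ t * f (x - t)) := by
      intro t
      simp only [diffOp, mul_add, Finset.mul_sum, sub_add_eq_add_sub]
      congr 1
      · congr 1
        · exact Finset.sum_congr rfl fun i _ => by ring
        · ring
      · ring
    have J1 : ∀ i, Integrable (fun t => (ρ t * f (x + s • e i - t) + ρ t * f (x + s • (-e i) - t)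
            - 2 * (ρ t * f (x - t))) / s ^ 2) := fun i =>
      (((Iy _).add (Iy _)).sub ((Iy _).const_mul _)).div_const _
    have J2 : Integrable (fun t => (ρ t * f (x + s • K.2.1 - t) - ρ t * f (x - t)) / s) :=
      ((Iy _).sub (Iy _)).div_const _
    have J3 : Integrable (fun t => ∑ i, (ρ t * f (x + s • e i - t) + ρ t * f (x + s • (-e i) - t)
            - 2 * (ρ t * f (x - t))) / s ^ 2
          + (ρ t * f (x + s • K.2.1 - t) - ρ t * f (x - t)) / s) :=
      (integrable_finsetSum _ fun i _ => J1 i).add J2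
    simp_rw [e1]
    rw [integral_add J3 ((Iy _).const_mul _),
      integral_add (integrable_finsetSum _ fun i _ => J1 i) J2,
      integral_finsetSum _ fun i _ => J1 i, integral_const_mul, integral_div,
      integral_sub (Iy _) (Iy _)]
    simp only [diffOp, vdef]
    congr 2
    refine Finset.sum_congr rfl fun i _ => ?_
    have J4 : Integrable (fun t => ρ t * f (x + s • e i - t) + ρ t * f (x + s • (-e i) - t)) :=
      (Iy _).add (Iy _)
    rw [integral_div, integral_sub J4 ((Iy _).const_mul _),
      integral_add (Iy _) (Iy _), integral_const_mul]
  set C := ∑ i, lam * ‖e i‖ ^ 2 + (L * ‖K.2.1‖ + lam / 2 * ‖K.2.1‖ ^ 2) + |K.1| * B with hC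
  have low : ∀ s ∈ Ioc (0 : ℝ) 1, ∀ z, -C ≤ diffOp K.1 K.2.1 e s f z := fun s hs z =>
    hq.le_diffOp hlam hL hB K.1 K.2.1 e hs z
  have dcont : ∀ s : ℝ, Continuous fun t => diffOp K.1 K.2.1 e s f (x - t) := by
    intro s
    unfold diffOp
    fun_prop
  have small : ∀ᶠ s : ℝ in 𝓝[>] 0, s ∈ Ioc (0 : ℝ) 1 := Ioc_mem_nhdsGT zero_lt_one
  -- Difference quotients of $f$ have no uniform upper bound, so they are truncated at $k$. Almost
  -- everywhere on the support of $\rho$ their limits are at least $k$, so the truncated ones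
  -- converge to $k$; dropping the truncation only increases the integral.
  have lim1 : Tendsto (fun s : ℝ => ∫ t, ρ t * min (diffOp K.1 K.2.1 e s f (x - t)) k) (𝓝[>] 0)
      (𝓝 (∫ t, ρ t * k)) := by
    refine tendsto_integral_filter_of_dominated_convergence (fun t => ρ t * (|C| + |k|)) ?_ ?_ ?_ ?_
    · exact Eventually.of_forall fun s =>
        (ρcont.mul ((dcont s).min continuous_const)).aestronglyMeasurable
    · filter_upwards [small] with s hs
      refine Eventually.of_forall fun t => ?_
      rw [norm_mul, Real.norm_of_nonneg (ρnn t), Real.norm_eq_abs]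
      refine mul_le_mul_of_nonneg_left ?_ (ρnn t)
      have h1 := low s hs (x - t)
      have h2 := neg_abs_le k
      have h3 := le_abs_self C
      have h4 := le_abs_self k
      have h5 := abs_nonneg C
      have h6 := abs_nonneg k
      rw [abs_le]
      exact ⟨le_min (by linarith) (by linarith), (min_le_right _ _).trans (by linarith)⟩
    · exact integ _ continuous_const
    · have hae : ∀ᵐ t, ∃ J, HasJetExpansion f (x - t) J :=
        (Measure.measurePreserving_sub_left volume x).quasiMeasurePreserving.ae (hq.ae_hasJetExpansion hf)
      filter_upwards [hae] with t ⟨J', hJ'⟩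
      by_cases hU : x - t ∈ U
      · have h1 := hsub.le_of_hasJetExpansion hU hJ'
        have h2 := (hJ'.tendsto_diffOp he).min (tendsto_const_nhds (x := k))
        rw [min_eq_right h1] at h2
        exact h2.const_mul _
      · have h0 : ρ t = 0 := by
          by_contra hne
          have : t ∈ Function.support ρ := hne
          rw [hρ, φ.support_normed_eq, mem_ball_zero_iff] at this
          exact hU (hx (by rwa [mem_ball_iff_norm, sub_sub_cancel_left, norm_neg]))
        simp [h0]
  rw [integral_mul_const, ρint, one_mul] at lim1
  have lim2 := hJ.hasJetExpansion.tendsto_diffOp he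
  refine le_of_tendsto_of_tendsto lim1 lim2 ?_
  filter_upwards with s
  rw [diff_eq]
  refine integral_mono (integ _ ((dcont s).min continuous_const)) (integ _ (dcont s)) fun t => ?_
  exact mul_le_mul_of_nonneg_left (min_le_left _ _) (ρnn t)

end Mollification

/-! ### Sup-convolution and smooth approximation of subsolutions. -/

section SupConvolution

open MeasureTheory

variable {n : ℕ}

theorem HasQuadSupport.abs_sub_le {E : Type*} [NormedAddCommGroup E] [InnerProductSpace ℝ E]
    {f : E → ℝ} {q : E → E} {lam L : ℝ} (hq : HasQuadSupport f q lam) (hL : ∀ x, ‖q x‖ ≤ L)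
    (x y : E) : |f x - f y| ≤ L * ‖x - y‖ + lam / 2 * ‖x - y‖ ^ 2 := by
  have key : ∀ x y, f x - f y ≤ L * ‖x - y‖ + lam / 2 * ‖x - y‖ ^ 2 := by
    intro x y
    have h1 := hq x y
    have h2 := neg_le_of_abs_le (abs_real_inner_le_norm (q x) (y - x))
    have h3 : ‖q x‖ * ‖y - x‖ ≤ L * ‖y - x‖ := by gcongr; exact hL x
    rw [norm_sub_rev x y]
    linarith
  rw [abs_le]
  refine ⟨?_, key x y⟩
  have := key y x
  rw [norm_sub_rev] at this
  linarith

theorem HasQuadSupport.continuous {E : Type*} [NormedAddCommGroup E] [InnerProductSpace ℝ E]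
    {f : E → ℝ} {q : E → E} {lam L : ℝ} (hq : HasQuadSupport f q lam) (hL : ∀ x, ‖q x‖ ≤ L) :
    Continuous f := by
  rw [continuous_iff_continuousAt]
  intro x
  rw [ContinuousAt, tendsto_iff_dist_tendsto_zero]
  have lim : Tendsto (fun y => L * ‖y - x‖ + lam / 2 * ‖y - x‖ ^ 2) (𝓝 x)
      (𝓝 (L * ‖x - x‖ + lam / 2 * ‖x - x‖ ^ 2)) := Continuous.tendsto (by fun_prop) x
  simp only [sub_self, norm_zero, mul_zero, ne_eq, OfNat.ofNat_ne_zero, not_false_eq_true,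
    zero_pow, add_zero] at lim
  exact squeeze_zero (fun _ => dist_nonneg) (fun y => by
    rw [Real.dist_eq]; exact hq.abs_sub_le hL y x) lim

/-- The sup-convolution of a bounded upper semicontinuous function, with a selection `m` of
points at which the supremum is attained. -/
theorem exists_supConvolution {u : EuclideanSpace ℝ (Fin n) → ℝ} (hu : UpperSemicontinuous u)
    {B : ℝ} (hB : ∀ y, |u y| ≤ B) {eps : ℝ} (heps : 0 < eps) :
    ∃ (f : EuclideanSpace ℝ (Fin n) → ℝ)
      (m : EuclideanSpace ℝ (Fin n) → EuclideanSpace ℝ (Fin n)),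
      (∀ x, f x = u (m x) - ‖x - m x‖ ^ 2 / (2 * eps)) ∧
        ∀ x y, u y - ‖x - y‖ ^ 2 / (2 * eps) ≤ f x := by
  have hB0 : 0 ≤ B := (abs_nonneg _).trans (hB 0)
  have key : ∀ x, ∃ z, ∀ y, u y - ‖x - y‖ ^ 2 / (2 * eps) ≤ u z - ‖x - z‖ ^ 2 / (2 * eps) := by
    intro x
    -- Outside this ball the penalty exceeds $2B$, the largest possible gain in $u$, so maximising
    -- over the ball is enough.
    have hc : UpperSemicontinuousOn (fun y => u y + -(‖x - y‖ ^ 2 / (2 * eps)))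
        (Metric.closedBall x (Real.sqrt (4 * eps * B))) :=
      (hu.upperSemicontinuousOn _).add
        ((Continuous.upperSemicontinuous (f := fun y => -(‖x - y‖ ^ 2 / (2 * eps)))
          (by fun_prop)).upperSemicontinuousOn _)
    obtain ⟨z, hz, hmax⟩ := hc.exists_isMaxOn ⟨x, Metric.mem_closedBall_self (by positivity)⟩
      (isCompact_closedBall _ _)
    refine ⟨z, fun y => ?_⟩
    by_cases hy : y ∈ Metric.closedBall x (Real.sqrt (4 * eps * B))
    · exact hmax hy
    · have h1 : u x + -(‖x - x‖ ^ 2 / (2 * eps)) ≤ u z + -(‖x - z‖ ^ 2 / (2 * eps)) :=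
        hmax (Metric.mem_closedBall_self (by positivity))
      rw [sub_self, norm_zero] at h1
      rw [Metric.mem_closedBall, not_le, dist_comm, dist_eq_norm] at hy
      have hy2 := Real.lt_sq_of_sqrt_lt hy
      have h2 : 2 * B ≤ ‖x - y‖ ^ 2 / (2 * eps) := by
        rw [le_div_iff₀ (by positivity)]; linarith
      have h3 := (abs_le.1 (hB y)).2
      have h4 := (abs_le.1 (hB x)).1
      norm_num at h1
      linarith
  choose m hm using key
  exact ⟨fun x => u (m x) - ‖x - m x‖ ^ 2 / (2 * eps), m, fun _ => rfl, hm⟩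

/-- The constraint does not depend on the point: a test polynomial for $f$ at $x$, raised by
$u(m(x))-f(x)\ge0$, tests $u$ at $m(x)$ with the same $p$ and $A$. Monotonicity in $r$ allows
lowering the value again. -/
theorem IsQuadSubsolution.supConvolution {G : Set (Jet n)} {U : Set (EuclideanSpace ℝ (Fin n))}
    {u f : EuclideanSpace ℝ (Fin n) → ℝ} {m : EuclideanSpace ℝ (Fin n) → EuclideanSpace ℝ (Fin n)}
    {eps : ℝ} (heps : 0 < eps) (hu : IsQuadSubsolution G U u)
    (hG : ∀ (r r' : ℝ) (p : EuclideanSpace ℝ (Fin n)) (A : symMat n),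
      (r, p, A) ∈ G → r' ≤ r → (r', p, A) ∈ G)
    (hf : ∀ x, f x = u (m x) - ‖x - m x‖ ^ 2 / (2 * eps))
    (hm : ∀ x y, u y - ‖x - y‖ ^ 2 / (2 * eps) ≤ f x) :
    IsQuadSubsolution G {x | m x ∈ U} f := by
  intro x hx p A htouch
  refine hG (u (m x)) _ p A (hu (m x) hx p A ?_) ?_
  · filter_upwards [htouch] with h hh
    have h1 := hm (x + h) (m x + h)
    rw [add_sub_add_right_eq_sub] at h1
    simp only [jetPoly] at hh ⊢
    have := hf x
    linarith
  · rw [hf x]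
    have : 0 ≤ ‖x - m x‖ ^ 2 / (2 * eps) := by positivity
    linarith

open scoped Convolution

/-- Approximation of a bounded viscosity subsolution of a family of linear equations with constant
coefficients by classical subsolutions. -/
theorem exists_smooth_subsolution {ι : Type*} {K : ι → Jet n} {k : ι → ℝ}
    (hK : ∀ σ, K σ ∈ properEllipticCoeffs n) {U : Set (EuclideanSpace ℝ (Fin n))}
    {u : EuclideanSpace ℝ (Fin n) → ℝ} (hu : UpperSemicontinuous u) {B : ℝ} (hB : ∀ y, |u y| ≤ B)
    (hsub : IsQuadSubsolution {J | ∀ σ, k σ ≤ jetInner (K σ) J} U u) {δ κ : ℝ} (hδ : 0 < δ)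
    (hκ : 0 < κ) :
    ∃ v : EuclideanSpace ℝ (Fin n) → ℝ, ContDiff ℝ 2 v ∧ (∀ x, u x - κ ≤ v x) ∧
      (∀ x, ∃ y, ‖x - y‖ < δ ∧ v x ≤ u y + κ) ∧
      ∀ x, Metric.ball x δ ⊆ U → ∀ J, IsTwoJet v x J → ∀ σ, k σ ≤ jetInner (K σ) J := by
  have hB0 : 0 ≤ B := (abs_nonneg _).trans (hB 0)
  -- Gives $|x-m(x)|^2\le4\,\mathrm{eps}\,B\le\delta^2/8$, so the maximising point is closer than
  -- $\delta/2$.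
  set eps := δ ^ 2 / (32 * (B + 1)) with heps_def
  have heps : 0 < eps := by positivity
  obtain ⟨f, m, hf, hm⟩ := exists_supConvolution hu hB heps
  have uf : ∀ x, u x ≤ f x := fun x => by simpa using hm x x
  have fu : ∀ x, f x ≤ u (m x) := fun x => by
    rw [hf x]
    have : 0 ≤ ‖x - m x‖ ^ 2 / (2 * eps) := by positivity
    linarith
  have dist_m : ∀ x, ‖x - m x‖ < δ / 2 := by
    intro x
    have h1 := uf x
    rw [hf x] at h1
    have h2 := (abs_le.1 (hB x)).1
    have h3 := (abs_le.1 (hB (m x))).2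
    have h4 : ‖x - m x‖ ^ 2 / (2 * eps) ≤ 2 * B := by linarith
    rw [div_le_iff₀ (by positivity), heps_def] at h4
    have h5 : 2 * B * (2 * (δ ^ 2 / (32 * (B + 1)))) ≤ δ ^ 2 / 8 := by
      have : 2 * B * (2 * (δ ^ 2 / (32 * (B + 1)))) = δ ^ 2 / 8 * (B / (B + 1)) := by
        field_simp; ring
      rw [this]
      exact mul_le_of_le_one_right (by positivity) (by rw [div_le_one (by positivity)]; linarith)
    have h6 : ‖x - m x‖ ^ 2 < (δ / 2) ^ 2 := by nlinarith [sq_pos_of_pos hδ]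
    exact lt_of_pow_lt_pow_left₀ 2 (by positivity) h6
  have fB : ∀ x, |f x| ≤ B := fun x =>
    abs_le.2 ⟨(abs_le.1 (hB x)).1.trans (uf x), (fu x).trans (abs_le.1 (hB (m x))).2⟩
  -- Slope at $x$ of the paraboloid centred at $m(x)$ that realises the supremum there and lies
  -- below $f$ everywhere.
  set q := fun x => (1 / eps) • (m x - x) with hq_def
  have hq : HasQuadSupport f q (1 / eps) := by
    intro x y
    refine le_trans (le_of_eq ?_) (hm y (m x))
    rw [hf x, hq_def, real_inner_smul_left]
    have e : y - m x = (y - x) - (m x - x) := by abel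
    rw [e, norm_sub_sq_real (y - x), norm_sub_rev x (m x), real_inner_comm (m x - x) (y - x)]
    field_simp
    ring
  set L := 1 / eps * (δ / 2) with hL_def
  have hL : ∀ x, ‖q x‖ ≤ L := by
    intro x
    rw [hq_def, norm_smul, Real.norm_of_nonneg (by positivity), norm_sub_rev]
    exact mul_le_mul_of_nonneg_left (dist_m x).le (by positivity)
  have fcont : Continuous f := hq.continuous hL
  -- The first entry spends the other half of $\delta$, so that $m$ maps the mollification ball
  -- around $x$ into the $\delta$-ball. The other two keep the convolution within $\kappa$ of $f$.
  set r := min (δ / 2) (min 1 (κ / (L + 1 / eps / 2 + 1))) with hr_def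
  have hL0 : 0 ≤ L := by positivity
  have hr : 0 < r := by positivity
  have hr1 : r ≤ δ / 2 := min_le_left _ _
  have hr2 : r ≤ 1 := (min_le_right _ _).trans (min_le_left _ _)
  have hr3 : r * (L + 1 / eps / 2 + 1) ≤ κ := by
    rw [← le_div_iff₀ (by positivity)]
    exact (min_le_right _ _).trans (min_le_right _ _)
  let φ : ContDiffBump (0 : EuclideanSpace ℝ (Fin n)) := ⟨r / 2, r, by positivity, by linarith⟩
  have close : ∀ x, |(φ.normed volume ⋆[ContinuousLinearMap.lsmul ℝ ℝ, volume] f) x - f x| ≤ κ := by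
    intro x
    rw [← Real.dist_eq]
    refine φ.dist_normed_convolution_le fcont.aestronglyMeasurable fun y hy => ?_
    have hy' : ‖y - x‖ < r := by rwa [mem_ball_iff_norm] at hy
    rw [Real.dist_eq]
    refine (hq.abs_sub_le hL y x).trans ?_
    have a1 : L * ‖y - x‖ ≤ L * r := by gcongr
    have a2 : 1 / eps / 2 * ‖y - x‖ ^ 2 ≤ 1 / eps / 2 * r := by
      gcongr
      nlinarith [norm_nonneg (y - x)]
    linarith
  refine ⟨φ.normed volume ⋆[ContinuousLinearMap.lsmul ℝ ℝ, volume] f,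
    φ.hasCompactSupport_normed.contDiff_convolution_left _ φ.contDiff_normed
    fcont.locallyIntegrable, fun x => ?_, fun x => ⟨m x, (dist_m x).trans (by linarith), ?_⟩,
    fun x hx J hJ σ => ?_⟩
  · linarith [(abs_le.1 (close x)).1, uf x]
  · linarith [(abs_le.1 (close x)).2, fu x]
  · have hσ : IsQuadSubsolution {J | k σ ≤ jetInner (K σ) J} U u :=
      fun y hy p A htouch => hsub y hy p A htouch σ
    refine (hσ.supConvolution heps ?_ hf hm).le_jetInner_mollification (hK σ).2 hq (by positivity)
      hL fB fcont φ (fun y hy => ?_) hJ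
    · intro r r' p A hr hr'
      have := mul_le_mul_of_nonpos_left hr' (hK σ).1
      simp only [jetInner, mem_ofPred_eq] at hr ⊢
      linarith
    · apply hx
      have hy' : ‖y - x‖ < r := by rwa [mem_ball_iff_norm] at hy
      rw [mem_ball_iff_norm]
      have e : m y - x = (y - x) - (y - m y) := by abel
      rw [e]
      have := norm_sub_le (y - x) (y - m y)
      linarith [dist_m y]

end SupConvolution

/-! ### The inner product on the space of 2-jets. -/

section JetGeometry

variable {n : ℕ}

/-- `jetInner` as a bilinear map. -/
noncomputable def jetBilin (n : ℕ) : Jet n →ₗ[ℝ] Jet n →ₗ[ℝ] ℝ :=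
  LinearMap.mk₂ ℝ jetInner
    (fun J J' K => by
      simp only [jetInner, Prod.fst_add, Prod.snd_add, Submodule.coe_add, Matrix.add_mul,
        Matrix.trace_add, inner_add_left]
      ring)
    (fun t J K => by
      simp only [jetInner, Prod.smul_fst, Prod.smul_snd, Submodule.coe_smul, Matrix.smul_mul,
        Matrix.trace_smul, real_inner_smul_left, smul_eq_mul]
      ring)
    jetInner_add_right (fun t K J => jetInner_smul_right K t J)

theorem jetBilin_apply (J K : Jet n) : jetBilin n J K = jetInner J K := rfl

theorem jetInner_zero_right (K : Jet n) : jetInner K 0 = 0 := (jetBilin n K).map_zero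

theorem jetInner_sub_right (K J J' : Jet n) :
    jetInner K (J - J') = jetInner K J - jetInner K J' := (jetBilin n K).map_sub J J'

theorem jetInner_neg_right (K J : Jet n) :
    jetInner K (-J) = - jetInner K J := (jetBilin n K).map_neg J

theorem jetInner_comm (J K : Jet n) : jetInner J K = jetInner K J := by
  simp only [jetInner]
  rw [Matrix.trace_mul_comm, real_inner_comm, mul_comm J.1]

theorem jetInner_self (J : Jet n) : jetInner J J =
    ∑ i, ∑ j, (J.2.2 : Matrix (Fin n) (Fin n) ℝ) i j ^ 2 + ‖J.2.1‖ ^ 2 + J.1 ^ 2 := by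
  have hA : ∀ i j, (J.2.2 : Matrix (Fin n) (Fin n) ℝ) j i = (J.2.2 : Matrix (Fin n) (Fin n) ℝ) i j :=
    fun i j => J.2.2.2.apply i j
  simp only [jetInner, Matrix.trace, Matrix.diag, Matrix.mul_apply, real_inner_self_eq_norm_sq]
  congr 1
  · congr 1
    refine Finset.sum_congr rfl fun i _ => Finset.sum_congr rfl fun j _ => ?_
    rw [hA i j, sq]
  · ring

theorem jetInner_self_nonneg (J : Jet n) : 0 ≤ jetInner J J := by
  rw [jetInner_self]
  positivity

theorem jetNorm_nonneg (J : Jet n) : 0 ≤ jetNorm J := Real.sqrt_nonneg _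

theorem jetNorm_sq (J : Jet n) : jetNorm J ^ 2 = jetInner J J :=
  Real.sq_sqrt (jetInner_self_nonneg J)

theorem abs_fst_le_jetNorm (J : Jet n) : |J.1| ≤ jetNorm J := by
  refine Real.abs_le_sqrt ?_
  rw [jetInner_self]
  have : 0 ≤ ∑ i, ∑ j, (J.2.2 : Matrix (Fin n) (Fin n) ℝ) i j ^ 2 + ‖J.2.1‖ ^ 2 := by positivity
  linarith

theorem norm_snd_le_jetNorm (J : Jet n) : ‖J.2.1‖ ≤ jetNorm J := by
  rw [← abs_norm]
  refine Real.abs_le_sqrt ?_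
  rw [jetInner_self]
  have : 0 ≤ ∑ i, ∑ j, (J.2.2 : Matrix (Fin n) (Fin n) ℝ) i j ^ 2 := by positivity
  nlinarith [sq_nonneg J.1]

theorem abs_entry_le_jetNorm (J : Jet n) (i j : Fin n) :
    |(J.2.2 : Matrix (Fin n) (Fin n) ℝ) i j| ≤ jetNorm J := by
  refine Real.abs_le_sqrt ?_
  rw [jetInner_self]
  have h1 : (J.2.2 : Matrix (Fin n) (Fin n) ℝ) i j ^ 2
      ≤ ∑ j, (J.2.2 : Matrix (Fin n) (Fin n) ℝ) i j ^ 2 :=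
    Finset.single_le_sum (f := fun j => (J.2.2 : Matrix (Fin n) (Fin n) ℝ) i j ^ 2)
      (fun _ _ => sq_nonneg _) (Finset.mem_univ j)
  have h2 : ∑ j, (J.2.2 : Matrix (Fin n) (Fin n) ℝ) i j ^ 2
      ≤ ∑ i, ∑ j, (J.2.2 : Matrix (Fin n) (Fin n) ℝ) i j ^ 2 :=
    Finset.single_le_sum (f := fun i => ∑ j, (J.2.2 : Matrix (Fin n) (Fin n) ℝ) i j ^ 2)
      (fun _ _ => Finset.sum_nonneg fun _ _ => sq_nonneg _) (Finset.mem_univ i)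
  nlinarith [sq_nonneg J.1, sq_nonneg ‖J.2.1‖]

theorem jetNorm_pos {J : Jet n} (hJ : J ≠ 0) : 0 < jetNorm J := by
  refine (jetNorm_nonneg J).lt_of_ne fun h => hJ ?_
  refine Prod.ext (abs_nonpos_iff.1 (h ▸ abs_fst_le_jetNorm J))
    (Prod.ext (norm_le_zero_iff.1 (h ▸ norm_snd_le_jetNorm J)) (Subtype.ext ?_))
  ext i j
  exact abs_nonpos_iff.1 (h ▸ abs_entry_le_jetNorm J i j)

theorem abs_jetInner_le (J K : Jet n) : |jetInner J K| ≤ jetNorm J * jetNorm K := by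
  have h := LinearMap.BilinForm.apply_sq_le_of_symm (jetBilin n) (fun J => jetInner_self_nonneg J)
    ⟨fun J K => jetInner_comm J K⟩ J K
  simp only [jetBilin_apply] at h
  rw [← jetNorm_sq, ← jetNorm_sq, ← mul_pow] at h
  exact abs_le_of_sq_le_sq h (mul_nonneg (jetNorm_nonneg _) (jetNorm_nonneg _))

theorem continuous_jetInner : Continuous fun J : Jet n × Jet n => jetInner J.1 J.2 := by
  unfold jetInner
  have h1 : Continuous fun J : Jet n × Jet n => (J.1.2.2 : Matrix (Fin n) (Fin n) ℝ) := by fun_prop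
  have h2 : Continuous fun J : Jet n × Jet n => (J.2.2.2 : Matrix (Fin n) (Fin n) ℝ) := by fun_prop
  exact ((h1.matrix_mul h2).matrix_trace.add (by fun_prop)).add (by fun_prop)

theorem continuous_jetNorm : Continuous (jetNorm (n := n)) := by
  have h : Continuous fun J : Jet n => jetInner J J :=
    continuous_jetInner.comp₂ continuous_id continuous_id
  exact Real.continuous_sqrt.comp h

/-- Writing the matrix coefficient as $\sum e_ie_i^{\mathsf T}$ makes every term nonnegative. This
is the source of (P) and (N) for the half-spaces, and of every later step that discards a
nonpositive value or a nonnegative matrix. -/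
theorem jetInner_nonneg_of_psd {K : Jet n} (hK : K ∈ properEllipticCoeffs n) {s : ℝ} (hs : s ≤ 0)
    {P : symMat n} (hP : P ∈ psd n) : 0 ≤ jetInner K (s, 0, P) := by
  obtain ⟨m, e, he⟩ := exists_eq_sum_vecMulVec hK.2
  have h1 : 0 ≤ K.1 * s := mul_nonneg_of_nonpos_of_nonpos hK.1 hs
  have h2 : 0 ≤ ∑ i, matQuad P (e i) := Finset.sum_nonneg fun i _ => (mem_psd_iff P).1 hP _
  simp only [jetInner, inner_zero_right, trace_mul_eq_sum_matQuad e _ _ he]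
  linarith

/-- The vectors of jet norm at most `1` are absorbed uniformly by neighbourhoods of a point. -/
theorem exists_pos_forall_add_smul_mem {U : Set (Jet n)} {J₀ : Jet n} (hU : U ∈ 𝓝 J₀) :
    ∃ t : ℝ, 0 < t ∧ ∀ J, jetNorm J ≤ 1 → J₀ + t • J ∈ U := by
  let _ : NormedAddCommGroup (Matrix (Fin n) (Fin n) ℝ) := Matrix.normedAddCommGroup
  let _ : NormedSpace ℝ (Matrix (Fin n) (Fin n) ℝ) := Matrix.normedSpace
  obtain ⟨r, hr, hball⟩ := Metric.mem_nhds_iff.1 hU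
  refine ⟨r / 2, half_pos hr, fun J hJ => hball ?_⟩
  have hn : ‖J‖ ≤ 1 := by
    refine max_le ((abs_fst_le_jetNorm J).trans hJ) (max_le ((norm_snd_le_jetNorm J).trans hJ) ?_)
    change ‖(J.2.2 : Matrix (Fin n) (Fin n) ℝ)‖ ≤ 1
    rw [Matrix.norm_le_iff zero_le_one]
    exact fun i j => (abs_entry_le_jetNorm J i j).trans hJ
  rw [mem_ball_iff_norm, add_sub_cancel_left, norm_smul, Real.norm_of_nonneg (half_pos hr).le]
  nlinarith

end JetGeometry

/-! ### Pointed families and the canonical operator. -/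

section PointedFamilies

variable {n : ℕ} {ι : Type*} {S : ι → Jet n} {J₀ : Jet n}

theorem isConvexCone_iInter_halfSpace (S : ι → Jet n) : IsConvexCone (⋂ σ, halfSpace (S σ)) := by
  refine ⟨⟨0, mem_iInter.2 fun σ => (jetInner_zero_right (S σ)).ge⟩,
    convex_iInter fun σ J hJ J' hJ' a b ha hb _ => ?_, fun t ht J hJ => mem_iInter.2 fun σ => ?_⟩
  · change 0 ≤ jetInner _ _
    rw [jetInner_add_right, jetInner_smul_right, jetInner_smul_right]
    exact add_nonneg (mul_nonneg ha hJ) (mul_nonneg hb hJ')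
  · change 0 ≤ jetInner _ _
    rw [jetInner_smul_right]
    exact mul_nonneg ht (mem_iInter.1 hJ σ)

/-- A convex cone is closed under addition, being stable under midpoints and doubling. The other
inclusion tests $t=1$ against the vertex $0$. -/
theorem maxMonotonicityCone_eq_of_isConvexCone {C : Set (Jet n)} (hC : IsConvexCone C) :
    maxMonotonicityCone C = C := by
  obtain ⟨⟨J₁, hJ₁⟩, hconv, hcone⟩ := hC
  have h0 : (0 : Jet n) ∈ C := by simpa using hcone 0 le_rfl J₁ hJ₁
  ext J
  constructor
  · intro h
    simpa using h 1 ⟨zero_le_one, le_rfl⟩ 0 h0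
  · intro hJ t ht J' hJ'
    have h1 := hconv hJ' (hcone t ht.1 J hJ) (by norm_num : (0 : ℝ) ≤ 1 / 2)
      (by norm_num : (0 : ℝ) ≤ 1 / 2) (by norm_num)
    have h2 := hcone 2 zero_le_two _ h1
    rw [← smul_add, smul_smul] at h2
    simpa using h2

theorem exists_isPointedWithAxis_of_isSubequation [Nonempty ι] (hS_ne : ∀ σ, S σ ≠ 0)
    (h : IsSubequation (⋂ σ, halfSpace (S σ))) : ∃ J₀ : Jet n, IsPointedWithAxis S J₀ := by
  have hint : (interior (⋂ σ, halfSpace (S σ))).Nonempty := by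
    rw [← closure_nonempty_iff, ← h.topological]
    exact h.nonempty
  obtain ⟨J₀, hJ₀⟩ := hint
  obtain ⟨t, ht, hmem⟩ := exists_pos_forall_add_smul_mem (mem_interior_iff_mem_nhds.1 hJ₀)
  have key : ∀ σ, t * jetNorm (S σ) ≤ jetInner (S σ) J₀ := by
    intro σ
    have hpos := jetNorm_pos (hS_ne σ)
    -- The unit vector that decreases $\langle J_\sigma,\cdot\rangle$ fastest; moving by $t$ along
    -- it costs exactly $t\|J_\sigma\|$.
    set K : Jet n := (-(1 / jetNorm (S σ))) • S σ with hK
    have hKn : jetNorm K ≤ 1 := by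
      refine Real.sqrt_le_one.2 (le_of_eq ?_)
      rw [hK, jetInner_smul_right, jetInner_comm, jetInner_smul_right, ← jetNorm_sq]
      field_simp
    have h1 : 0 ≤ jetInner (S σ) (J₀ + t • K) := mem_iInter.1 (hmem K hKn) σ
    rw [jetInner_add_right, jetInner_smul_right, hK, jetInner_smul_right, ← jetNorm_sq] at h1
    have h2 : t * (-(1 / jetNorm (S σ)) * jetNorm (S σ) ^ 2) = -(t * jetNorm (S σ)) := by
      field_simp
    linarith
  refine ⟨J₀, ?_, t, ht, key⟩
  rintro rfl
  obtain ⟨σ⟩ := ‹Nonempty ι›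
  have h1 := key σ
  rw [jetInner_zero_right] at h1
  have := mul_pos ht (jetNorm_pos (hS_ne σ))
  linarith

theorem IsPointedWithAxis.jetInner_pos (h : IsPointedWithAxis S J₀) (hS_ne : ∀ σ, S σ ≠ 0)
    (σ : ι) : 0 < jetInner (S σ) J₀ := by
  obtain ⟨-, ε, hε, hp⟩ := h
  exact (mul_pos hε (jetNorm_pos (hS_ne σ))).trans_le (hp σ)

theorem IsPointedWithAxis.bddBelow_normalizedOp (h : IsPointedWithAxis S J₀)
    (hS_ne : ∀ σ, S σ ≠ 0) (J : Jet n) : BddBelow (range fun σ => normalizedOp (S σ) J₀ J) := by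
  have hpos := h.jetInner_pos hS_ne
  obtain ⟨-, ε, hε, hp⟩ := h
  refine ⟨-(jetNorm J / ε), ?_⟩
  rintro _ ⟨σ, rfl⟩
  change _ ≤ jetInner (S σ) J / jetInner (S σ) J₀
  rw [le_div_iff₀ (hpos σ)]
  have h1 := neg_le_of_abs_le (abs_jetInner_le (S σ) J)
  have h2 := mul_le_mul_of_nonneg_left (hp σ) (div_nonneg (jetNorm_nonneg J) hε.le)
  have h3 : jetNorm J / ε * (ε * jetNorm (S σ)) = jetNorm (S σ) * jetNorm J := by
    field_simp
  linarith

theorem IsPointedWithAxis.le_hjbOp_iff [Nonempty ι] (h : IsPointedWithAxis S J₀)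
    (hS_ne : ∀ σ, S σ ≠ 0) {c : ℝ} {J : Jet n} :
    c ≤ hjbOp S J₀ J ↔ ∀ σ, c * jetInner (S σ) J₀ ≤ jetInner (S σ) J := by
  rw [hjbOp, le_ciInf_iff (h.bddBelow_normalizedOp hS_ne J)]
  exact forall_congr' fun σ => le_div_iff₀ (h.jetInner_pos hS_ne σ)

theorem IsPointedWithAxis.iInter_halfSpace_eq [Nonempty ι] (h : IsPointedWithAxis S J₀)
    (hS_ne : ∀ σ, S σ ≠ 0) : ⋂ σ, halfSpace (S σ) = {J | 0 ≤ hjbOp S J₀ J} := by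
  ext J
  rw [mem_ofPred_eq, h.le_hjbOp_iff hS_ne, mem_iInter]
  simp [halfSpace]

theorem IsPointedWithAxis.hjbOp_add_smul [Nonempty ι] (h : IsPointedWithAxis S J₀)
    (hS_ne : ∀ σ, S σ ≠ 0) (J : Jet n) (t : ℝ) :
    hjbOp S J₀ (J + t • J₀) = hjbOp S J₀ J + t := by
  refine eq_of_forall_le_iff fun c => ?_
  rw [← sub_le_iff_le_add, h.le_hjbOp_iff hS_ne, h.le_hjbOp_iff hS_ne]
  refine forall_congr' fun σ => ?_
  rw [jetInner_add_right, jetInner_smul_right, sub_mul, sub_le_iff_le_add]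

theorem IsPointedWithAxis.concaveOn_hjbOp [Nonempty ι] (h : IsPointedWithAxis S J₀)
    (hS_ne : ∀ σ, S σ ≠ 0) : ConcaveOn ℝ univ (hjbOp S J₀) := by
  refine ⟨convex_univ, fun J _ J' _ a b ha hb _ => ?_⟩
  rw [h.le_hjbOp_iff hS_ne]
  intro σ
  have h1 := mul_le_mul_of_nonneg_left ((h.le_hjbOp_iff hS_ne).1 (le_refl (hjbOp S J₀ J)) σ) ha
  have h2 := mul_le_mul_of_nonneg_left ((h.le_hjbOp_iff hS_ne).1 (le_refl (hjbOp S J₀ J')) σ) hb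
  rw [jetInner_add_right, jetInner_smul_right, jetInner_smul_right, smul_eq_mul, smul_eq_mul]
  linarith

/-- $F$ is Lipschitz with constant $1/\varepsilon$ for `jetNorm`, since each normalised functional
is. -/
theorem IsPointedWithAxis.continuous_hjbOp [Nonempty ι] (h : IsPointedWithAxis S J₀)
    (hS_ne : ∀ σ, S σ ≠ 0) : Continuous (hjbOp S J₀) := by
  obtain ⟨-, ε, hε, hp⟩ := id h
  have key : ∀ J J', hjbOp S J₀ J - jetNorm (J' - J) / ε ≤ hjbOp S J₀ J' := by
    intro J J'
    rw [h.le_hjbOp_iff hS_ne]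
    intro σ
    have h1 := (h.le_hjbOp_iff hS_ne).1 (le_refl (hjbOp S J₀ J)) σ
    have h2 := neg_le_of_abs_le (abs_jetInner_le (S σ) (J' - J))
    rw [jetInner_sub_right] at h2
    have h3 := mul_le_mul_of_nonneg_left (hp σ) (div_nonneg (jetNorm_nonneg (J' - J)) hε.le)
    have h4 : jetNorm (J' - J) / ε * (ε * jetNorm (S σ)) = jetNorm (S σ) * jetNorm (J' - J) := by
      field_simp
    linarith
  have hsymm : ∀ J J' : Jet n, jetNorm (J - J') = jetNorm (J' - J) := by
    intro J J'
    rw [jetNorm, jetNorm, ← neg_sub J' J, jetInner_neg_right, jetInner_comm, jetInner_neg_right,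
      neg_neg]
  rw [continuous_iff_continuousAt]
  intro J
  rw [ContinuousAt, tendsto_iff_dist_tendsto_zero]
  have lim : Tendsto (fun J' => jetNorm (J' - J) / ε) (𝓝 J) (𝓝 (jetNorm (J - J) / ε)) :=
    Continuous.tendsto ((continuous_jetNorm.comp (continuous_id.sub continuous_const)).div_const ε) J
  rw [sub_self, jetNorm, jetInner_zero_right, Real.sqrt_zero, zero_div] at lim
  refine squeeze_zero (fun _ => dist_nonneg) (fun J' => ?_) lim
  have h1 := key J J'
  have h2 := key J' J
  rw [hsymm] at h2
  rw [Real.dist_eq, abs_le]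
  constructor <;> linarith

/-- $F$ grows at unit speed along $J_0$, so from a zero of $F$ any step in direction $-J_0$ leaves
the set. -/
theorem IsPointedWithAxis.frontier_iff [Nonempty ι] (h : IsPointedWithAxis S J₀)
    (hS_ne : ∀ σ, S σ ≠ 0) (J : Jet n) :
    J ∈ frontier (⋂ σ, halfSpace (S σ)) ↔ hjbOp S J₀ J = 0 := by
  have hcont := h.continuous_hjbOp hS_ne
  rw [h.iInter_halfSpace_eq hS_ne, (isClosed_le continuous_const hcont).frontier_eq]
  constructor
  · rintro ⟨h1, h2⟩
    by_contra hne
    refine h2 (mem_interior.2 ⟨{J | 0 < hjbOp S J₀ J}, fun J (hJ : 0 < hjbOp S J₀ J) => hJ.le,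
      isOpen_lt continuous_const hcont, lt_of_le_of_ne h1 (Ne.symm hne)⟩)
  · intro h0
    refine ⟨h0.ge, fun hint => ?_⟩
    have lim : Tendsto (fun t : ℝ => J + t • J₀) (𝓝[<] 0) (𝓝 J) := by
      have : Tendsto (fun t : ℝ => J + t • J₀) (𝓝 0) (𝓝 (J + (0 : ℝ) • J₀)) :=
        Continuous.tendsto (by fun_prop) _
      rw [zero_smul, add_zero] at this
      exact tendsto_nhdsWithin_of_tendsto_nhds this
    obtain ⟨t, ht, ht0⟩ := ((lim.eventually (mem_interior_iff_mem_nhds.1 hint)).and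
      self_mem_nhdsWithin).exists
    change 0 ≤ hjbOp S J₀ (J + t • J₀) at ht
    rw [h.hjbOp_add_smul hS_ne, h0] at ht
    have : t < 0 := ht0
    linarith

theorem IsPointedWithAxis.mem_interior [Nonempty ι] (h : IsPointedWithAxis S J₀)
    (hS_ne : ∀ σ, S σ ≠ 0) : J₀ ∈ interior (⋂ σ, halfSpace (S σ)) := by
  rw [h.iInter_halfSpace_eq hS_ne]
  refine _root_.mem_interior.2 ⟨{J | 0 < hjbOp S J₀ J}, fun J (hJ : 0 < hjbOp S J₀ J) => hJ.le,
    isOpen_lt continuous_const (h.continuous_hjbOp hS_ne), ?_⟩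
  have : (1 : ℝ) ≤ hjbOp S J₀ J₀ := (h.le_hjbOp_iff hS_ne).2 fun σ => by rw [one_mul]
  exact zero_lt_one.trans_le this

theorem IsPointedWithAxis.isClosed_iInter [Nonempty ι] (h : IsPointedWithAxis S J₀)
    (hS_ne : ∀ σ, S σ ≠ 0) : IsClosed (⋂ σ, halfSpace (S σ)) := by
  rw [h.iInter_halfSpace_eq hS_ne]
  exact isClosed_le continuous_const (h.continuous_hjbOp hS_ne)

theorem IsPointedWithAxis.eq_closure_interior [Nonempty ι] (h : IsPointedWithAxis S J₀)
    (hS_ne : ∀ σ, S σ ≠ 0) :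
    ⋂ σ, halfSpace (S σ) = closure (interior (⋂ σ, halfSpace (S σ))) := by
  rw [(isConvexCone_iInter_halfSpace S).2.1.closure_interior_eq_closure_of_nonempty_interior
    ⟨J₀, h.mem_interior hS_ne⟩, (h.isClosed_iInter hS_ne).closure_eq]

theorem IsPointedWithAxis.isConvexConeSubequation [Nonempty ι] (h : IsPointedWithAxis S J₀)
    (hS_ne : ∀ σ, S σ ≠ 0) (hS : ∀ σ, S σ ∈ properEllipticCoeffs n) :
    IsConvexConeSubequation (⋂ σ, halfSpace (S σ)) := by
  refine ⟨⟨(isConvexCone_iInter_halfSpace S).1, fun huniv => ?_, fun r p A P hJ hP => ?_,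
    fun r s p A hJ hs => ?_, h.eq_closure_interior hS_ne⟩, isConvexCone_iInter_halfSpace S⟩
  · obtain ⟨σ⟩ := ‹Nonempty ι›
    have h1 : -J₀ ∈ ⋂ σ, halfSpace (S σ) := huniv ▸ mem_univ _
    have h2 : 0 ≤ jetInner (S σ) (-J₀) := mem_iInter.1 h1 σ
    rw [jetInner_neg_right] at h2
    linarith [h.jetInner_pos hS_ne σ]
  · refine mem_iInter.2 fun σ => ?_
    have e : ((r, p, A + P) : Jet n) = (r, p, A) + (0, 0, P) := by simp
    change 0 ≤ jetInner _ _
    rw [e, jetInner_add_right]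
    exact add_nonneg (mem_iInter.1 hJ σ) (jetInner_nonneg_of_psd (hS σ) le_rfl hP)
  · refine mem_iInter.2 fun σ => ?_
    have e : ((r + s, p, A) : Jet n) = (r, p, A) + (s, 0, 0) := by simp
    change 0 ≤ jetInner _ _
    rw [e, jetInner_add_right]
    exact add_nonneg (mem_iInter.1 hJ σ) (jetInner_nonneg_of_psd (hS σ) hs Matrix.PosSemidef.zero)

theorem IsPointedWithAxis.isCanonicalOperator [Nonempty ι] (h : IsPointedWithAxis S J₀)
    (hS_ne : ∀ σ, S σ ≠ 0) (hS : ∀ σ, S σ ∈ properEllipticCoeffs n) :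
    IsCanonicalOperator (⋂ σ, halfSpace (S σ)) J₀ (hjbOp S J₀) := by
  -- The convex cone $\mathcal F$ serves as its own monotonicity cone.
  refine ⟨⟨⋂ σ, halfSpace (S σ), ⟨h.isClosed_iInter hS_ne, isConvexCone_iInter_halfSpace S, ?_,
    h.eq_closure_interior hS_ne⟩, ?_, h.mem_interior hS_ne⟩, fun J t => ?_⟩
  · rintro ⟨r, p, A⟩ ⟨hr, hp, hA⟩
    simp only at hr hp hA
    subst hp
    exact mem_iInter.2 fun σ => jetInner_nonneg_of_psd (hS σ) hr hA
  · intro J hJ J' hJ'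
    refine mem_iInter.2 fun σ => ?_
    change 0 ≤ jetInner _ _
    rw [jetInner_add_right]
    exact add_nonneg (mem_iInter.1 hJ σ) (mem_iInter.1 hJ' σ)
  · rw [h.frontier_iff hS_ne, h.hjbOp_add_smul hS_ne]
    constructor <;> intro h <;> linarith

theorem IsPointedWithAxis.halfSpace_properties (h : IsPointedWithAxis S J₀)
    (hS_ne : ∀ σ, S σ ≠ 0) (hS : ∀ σ, S σ ∈ properEllipticCoeffs n) (σ : ι) :
    IsConvexConeSubequation (halfSpace (S σ)) ∧
      IsCanonicalOperator (halfSpace (S σ)) J₀ (normalizedOp (S σ) J₀) := by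
  have h1 : IsPointedWithAxis (fun _ : Unit => S σ) J₀ := ⟨h.1, h.2.imp fun ε hε => ⟨hε.1, fun _ => hε.2 σ⟩⟩
  have e1 : ⋂ _ : Unit, halfSpace (S σ) = halfSpace (S σ) := iInter_const _
  have e2 : hjbOp (fun _ : Unit => S σ) J₀ = normalizedOp (S σ) J₀ := by
    funext J
    exact ciInf_const
  have a1 := h1.isConvexConeSubequation (fun _ => hS_ne σ) (fun _ => hS σ)
  have a2 := h1.isCanonicalOperator (fun _ => hS_ne σ) (fun _ => hS σ)
  rw [e1] at a1 a2
  rw [e2] at a2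
  exact ⟨a1, a2⟩

end PointedFamilies

/-! ### Truncation and semicontinuity of extended real functions. -/

section Semicontinuity

theorem EReal.coe_toReal_max {x : EReal} (hx : x ≠ ⊤) (a : ℝ) :
    ((max x (a : EReal)).toReal : EReal) = max x (a : EReal) := by
  refine EReal.coe_toReal ?_ ?_
  · exact (max_lt hx.lt_top (EReal.coe_lt_top a)).ne
  · exact ((EReal.bot_lt_coe a).trans_le (le_max_right _ _)).ne'

theorem UpperSemicontinuousOn.toReal_max {α : Type*} [TopologicalSpace α] {u : α → EReal}
    {K : Set α} (hu : UpperSemicontinuousOn u K) (htop : ∀ x ∈ K, u x ≠ ⊤) {g : α → ℝ}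
    (hg : Continuous g) : UpperSemicontinuousOn (fun x => (max (u x) (g x : EReal)).toReal) K := by
  have iff : ∀ x ∈ K, ∀ t : ℝ, (max (u x) (g x : EReal)).toReal < t ↔ u x < t ∧ g x < t := by
    intro x hx t
    rw [← EReal.coe_lt_coe_iff, EReal.coe_toReal_max (htop x hx), max_lt_iff, EReal.coe_lt_coe_iff]
  intro x hx t ht
  obtain ⟨h1, h2⟩ := (iff x hx t).1 ht
  filter_upwards [hu x hx t h1, self_mem_nhdsWithin,
    mem_nhdsWithin_of_mem_nhds (hg.continuousAt.eventually (gt_mem_nhds h2))] with z hz hzK hgz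
  exact (iff z hzK t).2 ⟨hz, hgz⟩

theorem UpperSemicontinuousOn.exists_le_coe {α : Type*} [TopologicalSpace α] {u : α → EReal}
    {K : Set α} (hu : UpperSemicontinuousOn u K) (hK : IsCompact K) (htop : ∀ x ∈ K, u x ≠ ⊤) :
    ∃ N : ℝ, ∀ x ∈ K, u x ≤ N := by
  rcases K.eq_empty_or_nonempty with rfl | hne
  · exact ⟨0, by simp⟩
  · obtain ⟨z, hz, hmax⟩ := hu.exists_isMaxOn hne hK
    exact ⟨(u z).toReal, fun x hx => (hmax hx).trans (EReal.le_coe_toReal (htop z hz))⟩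

theorem LowerSemicontinuousOn.neg_ereal {α : Type*} [TopologicalSpace α] {w : α → EReal}
    {K : Set α} (hw : LowerSemicontinuousOn w K) : UpperSemicontinuousOn (fun x => -w x) K := by
  intro x hx t ht
  filter_upwards [hw x hx (-t) (EReal.neg_lt_comm.1 ht)] with z hz using EReal.neg_lt_comm.1 hz

/-- If `f` is upper semicontinuous, `g` is upper semicontinuous on `K` and `f + g < 0` on a compact
subset `T` of `K`, then `f z + g x < 0` for `x ∈ T` and `z` uniformly close to `x`. -/
theorem exists_uniform_add_neg {α : Type*} [PseudoMetricSpace α] {f g : α → ℝ} {K T : Set α}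
    (hf : UpperSemicontinuous f) (hg : UpperSemicontinuousOn g K) (hT : IsCompact T) (hTK : T ⊆ K)
    (hneg : ∀ x ∈ T, f x + g x < 0) :
    ∃ δ > 0, ∀ x ∈ T, ∀ z, dist z x < δ → f z + g x < 0 := by
  -- Each function may grow by half of the negative gap at $x$; a Lebesgue number makes the radius
  -- uniform.
  have key : ∀ x : T, ∃ r > 0, ∀ z ∈ Metric.ball (x : α) r,
      f z < f x - (f x + g x) / 2 ∧ (z ∈ K → g z < g x - (f x + g x) / 2) := by
    intro x
    have h0 := hneg x x.2
    have h1 := hf x (f x - (f x + g x) / 2) (by linarith)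
    have h2 := eventually_nhdsWithin_iff.1 (hg x (hTK x.2) (g x - (f x + g x) / 2) (by linarith))
    exact Metric.eventually_nhds_iff_ball.1 (h1.and h2)
  choose r hr hball using key
  obtain ⟨δ, hδ, hsub⟩ := lebesgue_number_lemma_of_metric hT
    (c := fun x : T => Metric.ball (x : α) (r x)) (fun x => Metric.isOpen_ball)
    (fun x hx => mem_iUnion.2 ⟨⟨x, hx⟩, Metric.mem_ball_self (hr _)⟩)
  refine ⟨δ, hδ, fun x hx z hz => ?_⟩
  obtain ⟨i, hi⟩ := hsub x hx
  have h1 := (hball i z (hi hz)).1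
  have h2 := (hball i x (hi (Metric.mem_ball_self hδ))).2 (hTK hx)
  linarith

end Semicontinuity

/-! ### Paraboloids and ordering of jets at a contact point. -/

section Paraboloids

variable {n : ℕ}

/-- The 2-jet at `x` of the paraboloid `x ↦ |x - y|² / 2 - C`. -/
noncomputable def paraJet (y : EuclideanSpace ℝ (Fin n)) (C : ℝ) (x : EuclideanSpace ℝ (Fin n)) :
    Jet n := (‖x - y‖ ^ 2 / 2 - C, x - y, symOne n)

theorem continuous_paraJet (y : EuclideanSpace ℝ (Fin n)) (C : ℝ) : Continuous (paraJet y C) := by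
  unfold paraJet
  fun_prop

theorem jetPoly_smul_paraJet_add (y : EuclideanSpace ℝ (Fin n)) (C s a : ℝ)
    (x h : EuclideanSpace ℝ (Fin n)) :
    jetPoly (s • paraJet y C x + (a, 0, 0)) h = s * (‖x + h - y‖ ^ 2 / 2 - C) + a := by
  have e : x + h - y = (x - y) + h := by abel
  rw [jetPoly_add, e, norm_add_sq_real]
  simp only [jetPoly, paraJet, Prod.smul_fst, Prod.smul_snd, matQuad_const_smul, matQuad_symOne,
    real_inner_smul_left, inner_zero_left, smul_eq_mul]
  have : matQuad (0 : symMat n) h = 0 := by simp [matQuad]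
  rw [this]
  ring

/-- Along rays $tv$, the first order term forces equal gradients (take $v$ opposite to their
difference); the second order term then orders the Hessians. -/
theorem jet_le_of_jetPoly_le {J J' : Jet n} (h0 : J.1 = J'.1)
    (h : ∀ᶠ z in 𝓝 0, jetPoly J z ≤ jetPoly J' z) :
    J.2.1 = J'.2.1 ∧ J'.2.2 - J.2.2 ∈ psd n := by
  have key : ∀ v, ∀ᶠ t : ℝ in 𝓝[>] 0,
      0 ≤ inner ℝ (J'.2.1 - J.2.1) v + t * (1 / 2 * matQuad (J'.2.2 - J.2.2) v) := by
    intro v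
    have lim : Tendsto (fun t : ℝ => t • v) (𝓝[>] 0) (𝓝 0) := by
      have : Tendsto (fun t : ℝ => t • v) (𝓝 0) (𝓝 ((0 : ℝ) • v)) := tendsto_id.smul_const v
      rw [zero_smul] at this
      exact tendsto_nhdsWithin_of_tendsto_nhds this
    filter_upwards [lim.eventually h, self_mem_nhdsWithin] with t ht ht0
    have ht0' : 0 < t := ht0
    simp only [jetPoly, matQuad_smul, real_inner_smul_right, h0] at ht
    rw [inner_sub_left, matQuad_sub]
    have : 0 ≤ t * (inner ℝ J'.2.1 v - inner ℝ J.2.1 v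
        + t * (1 / 2 * (matQuad J'.2.2 v - matQuad J.2.2 v))) := by nlinarith
    exact nonneg_of_mul_nonneg_right this ht0'
  have hp : J'.2.1 - J.2.1 = 0 := by
    have lim : Tendsto (fun t : ℝ => inner ℝ (J'.2.1 - J.2.1) (-(J'.2.1 - J.2.1))
        + t * (1 / 2 * matQuad (J'.2.2 - J.2.2) (-(J'.2.1 - J.2.1)))) (𝓝[>] 0)
        (𝓝 (inner ℝ (J'.2.1 - J.2.1) (-(J'.2.1 - J.2.1))
        + 0 * (1 / 2 * matQuad (J'.2.2 - J.2.2) (-(J'.2.1 - J.2.1))))) :=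
      tendsto_nhdsWithin_of_tendsto_nhds ((tendsto_id.mul_const _).const_add _)
    have := ge_of_tendsto lim (key _)
    rw [zero_mul, add_zero, inner_neg_right, real_inner_self_eq_norm_sq] at this
    have h2 : ‖J'.2.1 - J.2.1‖ = 0 := by nlinarith [norm_nonneg (J'.2.1 - J.2.1)]
    exact norm_eq_zero.1 h2
  refine ⟨(sub_eq_zero.1 hp).symm, (mem_psd_iff _).2 fun v => ?_⟩
  obtain ⟨t, ht, ht0⟩ := ((key v).and self_mem_nhdsWithin).exists
  rw [hp, inner_zero_left, zero_add] at ht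
  have ht0' : 0 < t := ht0
  have := nonneg_of_mul_nonneg_right ht ht0'
  linarith

end Paraboloids

/-! ### Maximum of a subsolution and a paraboloid. -/

section Comparison

variable {n : ℕ} {ι : Type*} [Nonempty ι] {S : ι → Jet n} {J₀ : Jet n}

/-- The maximum of a viscosity subsolution and a paraboloid that is a classical subsolution. -/
theorem IsPointedWithAxis.isQuadSubsolution_of_max (h : IsPointedWithAxis S J₀)
    (hS_ne : ∀ σ, S σ ≠ 0) (hS : ∀ σ, S σ ∈ properEllipticCoeffs n) {c : ℝ}
    {Ω U : Set (EuclideanSpace ℝ (Fin n))} {u : EuclideanSpace ℝ (Fin n) → EReal}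
    (hu : IsViscositySubsolution (hjbOp S J₀) c Ω u) (hU : IsOpen U) (hUΩ : U ⊆ Ω)
    {y : EuclideanSpace ℝ (Fin n)} {C s a : ℝ} (hs : 0 ≤ s) (ha : a ≤ 0)
    (hpara : ∀ x ∈ U, c ≤ s * hjbOp S J₀ (paraJet y C x))
    {v : EuclideanSpace ℝ (Fin n) → ℝ}
    (hv : ∀ x ∈ U, (v x : EReal) = max (u x) ((s * (‖x - y‖ ^ 2 / 2 - C) + a : ℝ) : EReal)) :
    IsQuadSubsolution {J | ∀ σ, c * jetInner (S σ) J₀ ≤ jetInner (S σ) J} U v := by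
  intro x hx p A htouch
  have lim : Tendsto (fun z => z - x) (𝓝 x) (𝓝 0) := by
    have : Tendsto (fun z => z - x) (𝓝 x) (𝓝 (x - x)) := Continuous.tendsto (by fun_prop) x
    rwa [sub_self] at this
  -- A polynomial touching the maximum from above touches whichever of the two functions attains it
  -- at $x$.
  rcases le_total ((s * (‖x - y‖ ^ 2 / 2 - C) + a : ℝ) : EReal) (u x) with hcase | hcase
  · have hux : u x = (v x : EReal) := by rw [hv x hx, max_eq_left hcase]
    refine (h.le_hjbOp_iff hS_ne).1 (hu x (hUΩ hx) _
      ⟨fun z => jetPoly (v x, p, A) (z - x), isTwoJet_jetPoly _ _, ?_, ?_⟩)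
    · filter_upwards [lim.eventually htouch, hU.mem_nhds hx] with z hz hzU
      rw [add_sub_cancel] at hz
      calc u z ≤ (v z : EReal) := by rw [hv z hzU]; exact le_max_left _ _
        _ ≤ _ := EReal.coe_le_coe_iff.2 hz
    · simp [hux, jetPoly_zero]
  · have hvx : v x = s * (‖x - y‖ ^ 2 / 2 - C) + a := by
      rw [← EReal.coe_eq_coe_iff, hv x hx, max_eq_right hcase]
    have lim2 : Tendsto (fun z => x + z) (𝓝 0) (𝓝 x) := by
      have : Tendsto (fun z => x + z) (𝓝 0) (𝓝 (x + 0)) := Continuous.tendsto (by fun_prop) _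
      rwa [add_zero] at this
    obtain ⟨hp, hA⟩ := jet_le_of_jetPoly_le (J := s • paraJet y C x + (a, 0, 0))
      (J' := (v x, p, A)) (by simp [paraJet, hvx]) (by
        filter_upwards [htouch, lim2.eventually (hU.mem_nhds hx)] with z hz hzU
        refine le_trans ?_ hz
        rw [jetPoly_smul_paraJet_add, ← EReal.coe_le_coe_iff, hv _ hzU]
        exact le_max_right _ _)
    intro σ
    have e : ((v x, p, A) : Jet n) = s • paraJet y C x + (a, 0, A - s • symOne n) := by
      simp only [paraJet, Prod.snd_add, Prod.smul_snd, Prod.fst_add, Prod.smul_fst, add_zero] at hp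
      simp [paraJet, hvx, ← hp]
    have hA' : A - s • symOne n ∈ psd n := by simpa [paraJet] using hA
    rw [e, jetInner_add_right, jetInner_smul_right]
    have h1 := jetInner_nonneg_of_psd (hS σ) ha hA'
    have h2 := mul_le_mul_of_nonneg_left
      ((h.le_hjbOp_iff hS_ne).1 (le_refl (hjbOp S J₀ (paraJet y C x))) σ) hs
    have h3 := mul_le_mul_of_nonneg_right (hpara x hx) (h.jetInner_pos hS_ne σ).le
    linarith

end Comparison

/-! ### The comparison principle. -/

section Comparison

variable {n : ℕ} {ι : Type*} [Nonempty ι] {S : ι → Jet n} {J₀ : Jet n}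

/-- Comparison holds on bounded domains that carry a nonpositive paraboloid which is a strict
classical subsolution of the homogeneous equation. -/
theorem IsPointedWithAxis.comparisonPrinciple_of_paraJet (h : IsPointedWithAxis S J₀)
    (hS_ne : ∀ σ, S σ ≠ 0) (hS : ∀ σ, S σ ∈ properEllipticCoeffs n) (c : ℝ)
    {Ω : Set (EuclideanSpace ℝ (Fin n))} (hΩ : IsOpen Ω) (hbdd : Bornology.IsBounded Ω)
    {y : EuclideanSpace ℝ (Fin n)} {C : ℝ} (hneg : ∀ x ∈ closure Ω, ‖x - y‖ ^ 2 / 2 - C ≤ 0)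
    (hpos : ∀ x ∈ Ω, 0 < hjbOp S J₀ (paraJet y C x)) :
    ComparisonPrinciple (hjbOp S J₀) c Ω := by
  intro u w ⟨hu, hutop⟩ ⟨hw, hwbot⟩ husub hwsup hbd x₁ hx₁
  by_contra! hlt
  have hcpt : IsCompact (closure Ω) := hbdd.isCompact_closure
  have hx₁c : x₁ ∈ closure Ω := subset_closure hx₁
  set ψ : EuclideanSpace ℝ (Fin n) → ℝ := fun x => ‖x - y‖ ^ 2 / 2 - C with hψ
  have ψcont : Continuous ψ := by fun_prop
  have hC : 0 ≤ C := by
    have h1 := hneg x₁ hx₁c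
    have h2 : 0 ≤ ‖x₁ - y‖ ^ 2 / 2 := by positivity
    linarith
  have ψlow : ∀ x, -C ≤ ψ x := fun x => by
    have h2 : 0 ≤ ‖x - y‖ ^ 2 / 2 := by positivity
    simp only [hψ]
    linarith
  have ψneg : ∀ x ∈ closure Ω, ψ x ≤ 0 := hneg
  -- bounds and truncations
  have hw' := hw.neg_ereal
  have hwtop : ∀ x ∈ closure Ω, -w x ≠ ⊤ := fun x hx => by
    rw [ne_eq, EReal.neg_eq_top_iff]; exact hwbot x hx
  obtain ⟨N₁, hN₁⟩ := hu.exists_le_coe hcpt hutop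
  obtain ⟨N₂, hN₂⟩ := hw'.exists_le_coe hcpt hwtop
  obtain ⟨N, hN0, hNu, hNw⟩ : ∃ N : ℝ, 0 ≤ N ∧ (∀ x ∈ closure Ω, u x ≤ N) ∧
      ∀ x ∈ closure Ω, -w x ≤ N :=
    ⟨max 0 (max N₁ N₂), le_max_left _ _,
      fun x hx => (hN₁ x hx).trans (by norm_cast; exact (le_max_left _ _).trans (le_max_right _ _)),
      fun x hx => (hN₂ x hx).trans (by norm_cast; exact (le_max_right _ _).trans (le_max_right _ _))⟩
  set U : EuclideanSpace ℝ (Fin n) → ℝ := fun x => (max (u x) ((-N : ℝ) : EReal)).toReal with hU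
  set W : EuclideanSpace ℝ (Fin n) → ℝ := fun x => (max (-w x) ((-N : ℝ) : EReal)).toReal with hW
  have Uc : ∀ x ∈ closure Ω, (U x : EReal) = max (u x) ((-N : ℝ) : EReal) := fun x hx =>
    EReal.coe_toReal_max (hutop x hx) _
  have Wc : ∀ x ∈ closure Ω, (W x : EReal) = max (-w x) ((-N : ℝ) : EReal) := fun x hx =>
    EReal.coe_toReal_max (hwtop x hx) _
  have Uusc : UpperSemicontinuousOn U (closure Ω) := hu.toReal_max hutop continuous_const
  have Wusc : UpperSemicontinuousOn W (closure Ω) := hw'.toReal_max hwtop continuous_const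
  have UN : ∀ x ∈ closure Ω, U x ≤ N := fun x hx => by
    rw [← EReal.coe_le_coe_iff, Uc x hx]
    exact max_le (hNu x hx) (by norm_cast; linarith)
  have Wle : ∀ x ∈ closure Ω, ((-W x : ℝ) : EReal) ≤ w x := fun x hx => by
    rw [EReal.coe_neg, EReal.neg_le, Wc x hx]
    exact le_max_left _ _
  have bdUW : ∀ x ∈ frontier Ω, U x + W x ≤ 0 := by
    intro x hx
    have hxc := frontier_subset_closure hx
    have h1 : (U x : EReal) ≤ ((-W x : ℝ) : EReal) := by
      rw [EReal.coe_neg, EReal.le_neg, Wc x hxc, Uc x hxc]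
      refine max_le ?_ ?_
      · rw [EReal.neg_le_neg_iff]
        exact max_le (hbd x hx) (by rw [EReal.coe_neg, EReal.neg_le]; exact hNw x hxc)
      · rw [EReal.coe_neg, EReal.neg_le_neg_iff]
        exact max_le (hNu x hxc) (by norm_cast; linarith)
    have := EReal.coe_le_coe_iff.1 h1
    linarith
  have gap₁ : 0 < U x₁ + W x₁ := by
    have h1 : ((-W x₁ : ℝ) : EReal) < (U x₁ : EReal) :=
      (Wle x₁ hx₁c).trans_lt (hlt.trans_le (by rw [Uc x₁ hx₁c]; exact le_max_left _ _))
    have := EReal.coe_lt_coe_iff.1 h1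
    linarith
  set g := U x₁ + W x₁ with hg
  -- Small enough that the perturbation costs at most $g/4$ at $x_1$.
  set η := g / (4 * (|ψ x₁| + 1)) with hη
  have hη0 : 0 < η := by positivity
  have hηψ : -(g / 4) ≤ η * ψ x₁ := by
    have h1 : η * |ψ x₁| ≤ g / 4 := by
      have : η * |ψ x₁| = g / 4 * (|ψ x₁| / (|ψ x₁| + 1)) := by rw [hη]; field_simp
      rw [this]
      exact mul_le_of_le_one_right (by positivity) (by rw [div_le_one (by positivity)]; linarith)
    have h2 := mul_le_mul_of_nonneg_left (neg_abs_le (ψ x₁)) hη0.le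
    linarith
  -- the set where the perturbed difference is large, and its neighbourhoods
  have Dusc : UpperSemicontinuousOn (fun x => W x + (η * ψ x - g / 4)) (closure Ω) :=
    Wusc.add ((Continuous.upperSemicontinuous (f := fun x => η * ψ x - g / 4)
      (by fun_prop)).upperSemicontinuousOn _)
  -- This set avoids $\partial\Omega$, where $U+W\le0$ and $\psi\le0$.
  set K₀ := closure Ω ∩ (fun x => U x + (W x + (η * ψ x - g / 4))) ⁻¹' Ici 0 with hK₀
  have K₀cpt : IsCompact K₀ := (Uusc.add Dusc).isCompact_inter_preimage_Ici hcpt 0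
  have hx₁K₀ : x₁ ∈ K₀ := ⟨hx₁c, by change 0 ≤ U x₁ + (W x₁ + (η * ψ x₁ - g / 4)); linarith⟩
  have K₀Ω : K₀ ⊆ Ω := by
    rintro x ⟨hxc, hx0⟩
    by_contra hxΩ
    have hfr : x ∈ frontier Ω := by rw [hΩ.frontier_eq]; exact ⟨hxc, hxΩ⟩
    have h1 : 0 ≤ U x + (W x + (η * ψ x - g / 4)) := hx0
    have h2 := bdUW x hfr
    have h3 := mul_nonpos_of_nonneg_of_nonpos hη0.le (ψneg x hxc)
    linarith
  obtain ⟨d, hd, hdΩ⟩ := K₀cpt.exists_cthickening_subset_open hΩ K₀Ω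
  set K' := Metric.cthickening d K₀ with hK'
  have K'cpt : IsCompact K' := K₀cpt.cthickening
  have K'c : K' ⊆ closure Ω := hdΩ.trans subset_closure
  have hx₁K' : x₁ ∈ K' := Metric.self_subset_cthickening _ hx₁K₀
  -- the subsolution, made real valued by a paraboloid from below
  obtain ⟨z₀, hz₀, hmin⟩ := K'cpt.exists_isMinOn ⟨x₁, hx₁K'⟩
    ((h.continuous_hjbOp hS_ne).comp (continuous_paraJet y C)).continuousOn
  set δF := hjbOp S J₀ (paraJet y C z₀) with hδF
  have hδF0 : 0 < δF := hpos z₀ (hdΩ hz₀)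
  -- By homogeneity $s\psi$ then satisfies $F\ge|c|\ge c$ on $K'$, where compactness gives the
  -- positive lower bound `δF`. Replacing $u$ by its maximum with $s\psi-N$ removes the value
  -- $-\infty$.
  set s := |c| / δF with hs
  have hs0 : 0 ≤ s := by positivity
  set V : EuclideanSpace ℝ (Fin n) → ℝ := fun x => (max (u x) ((s * ψ x + -N : ℝ) : EReal)).toReal
    with hV
  have Vc : ∀ x ∈ closure Ω, (V x : EReal) = max (u x) ((s * ψ x + -N : ℝ) : EReal) := fun x hx =>
    EReal.coe_toReal_max (hutop x hx) _
  have Vusc : UpperSemicontinuousOn V (closure Ω) := hu.toReal_max hutop (by fun_prop)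
  have VU : ∀ x ∈ closure Ω, V x ≤ U x := by
    intro x hx
    rw [← EReal.coe_le_coe_iff, Vc x hx, Uc x hx]
    refine max_le_max le_rfl (EReal.coe_le_coe_iff.2 ?_)
    have := mul_nonpos_of_nonneg_of_nonpos hs0 (ψneg x hx)
    linarith
  set B := N + s * C with hB
  have hsC : 0 ≤ s * C := by positivity
  have VB : ∀ x ∈ closure Ω, -B ≤ V x := by
    intro x hx
    have h1 : ((s * ψ x + -N : ℝ) : EReal) ≤ (V x : EReal) := by rw [Vc x hx]; exact le_max_right _ _
    have h2 := EReal.coe_le_coe_iff.1 h1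
    have h3 := mul_le_mul_of_nonneg_left (ψlow x) hs0
    linarith
  classical
  -- The value $-B$ lies below $V$, so the extension stays upper semicontinuous across $\partial
  -- K'$.
  set v₀ : EuclideanSpace ℝ (Fin n) → ℝ := fun x => if x ∈ K' then V x else -B with hv₀
  have v₀V : ∀ x ∈ K', v₀ x = V x := fun x hx => if_pos hx
  have v₀abs : ∀ x, |v₀ x| ≤ B := by
    intro x
    by_cases hx : x ∈ K'
    · rw [v₀V x hx, abs_le]
      exact ⟨VB x (K'c hx), (VU x (K'c hx)).trans ((UN x (K'c hx)).trans (by linarith))⟩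
    · simp only [hv₀, if_neg hx, abs_neg]
      rw [abs_of_nonneg (by positivity)]
  have v₀N : ∀ x, v₀ x ≤ N := by
    intro x
    by_cases hx : x ∈ K'
    · rw [v₀V x hx]
      exact (VU x (K'c hx)).trans (UN x (K'c hx))
    · simp only [hv₀, if_neg hx]
      linarith
  have v₀usc : UpperSemicontinuous v₀ := by
    intro x t ht
    by_cases hx : x ∈ K'
    · rw [v₀V x hx] at ht
      have hBt : -B < t := (VB x (K'c hx)).trans_lt ht
      filter_upwards [eventually_nhdsWithin_iff.1 ((Vusc.mono K'c) x hx t ht)] with z hz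
      by_cases hzK : z ∈ K'
      · rw [v₀V z hzK]; exact hz hzK
      · simpa only [hv₀, if_neg hzK] using hBt
    · filter_upwards [K'cpt.isClosed.isOpen_compl.mem_nhds hx] with z hz
      simp only [hv₀, if_neg hx] at ht
      simpa only [hv₀, if_neg (show z ∉ K' from hz)] using ht
  have v₀sub : IsQuadSubsolution {J | ∀ σ, c * jetInner (S σ) J₀ ≤ jetInner (S σ) J}
      (interior K') v₀ := by
    refine h.isQuadSubsolution_of_max hS_ne hS husub isOpen_interior
      (interior_subset.trans hdΩ) (y := y) (C := C) hs0 (neg_nonpos.2 hN0) (fun x hx => ?_)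
      (fun x hx => ?_)
    · have h1 : δF ≤ hjbOp S J₀ (paraJet y C x) := hmin (interior_subset hx)
      calc c ≤ |c| := le_abs_self c
        _ = s * δF := by rw [hs]; field_simp
        _ ≤ _ := by gcongr
    · rw [v₀V x (interior_subset hx), Vc x (K'c (interior_subset hx))]
  -- smooth approximation
  set T := Metric.cthickening (d / 2) K₀ \ Metric.thickening (d / 2) K₀ with hT
  have KK' : Metric.cthickening (d / 2) K₀ ⊆ K' := Metric.cthickening_mono (by linarith) _
  have Tcpt : IsCompact T := K₀cpt.cthickening.diff Metric.isOpen_thickening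
  obtain ⟨ℓ, hℓ, hunif⟩ := exists_uniform_add_neg v₀usc Dusc Tcpt
    ((sdiff_subset.trans KK').trans K'c) (fun x hx => by
      have hxc := K'c (KK' hx.1)
      have hx0 : x ∉ K₀ := fun hx0 => hx.2 (Metric.self_subset_thickening (half_pos hd) _ hx0)
      have h1 : U x + (W x + (η * ψ x - g / 4)) < 0 := by
        by_contra! hcon
        exact hx0 ⟨hxc, hcon⟩
      have h2 := VU x hxc
      rw [v₀V x (KK' hx.1)]
      linarith)
  obtain ⟨v, vsmooth, vlow, vup, vsub⟩ := exists_smooth_subsolution hS v₀usc v₀abs v₀sub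
    (δ := min ℓ (d / 2)) (κ := g / 8) (by positivity) (by positivity)
  -- the maximum point
  have Musc : UpperSemicontinuousOn (fun x => W x + (v x + η * ψ x))
      (Metric.cthickening (d / 2) K₀) :=
    (Wusc.mono (KK'.trans K'c)).add ((Continuous.upperSemicontinuous (f := fun x => v x + η * ψ x)
      (vsmooth.continuous.add (by fun_prop))).upperSemicontinuousOn _)
  have hx₁K : x₁ ∈ Metric.cthickening (d / 2) K₀ := Metric.self_subset_cthickening _ hx₁K₀
  obtain ⟨x₂, hx₂, hmax⟩ := Musc.exists_isMaxOn ⟨x₁, hx₁K⟩ K₀cpt.cthickening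
  set M := W x₂ + (v x₂ + η * ψ x₂) with hM
  have hM0 : 5 * g / 8 ≤ M := by
    have h1 : W x₁ + (v x₁ + η * ψ x₁) ≤ M := hmax hx₁K
    have h2 := vlow x₁
    rw [v₀V x₁ hx₁K'] at h2
    have h3 : U x₁ ≤ V x₁ := by
      rw [← EReal.coe_le_coe_iff, Uc x₁ hx₁c, Vc x₁ hx₁c]
      refine max_le (le_max_left _ _) (le_trans (le_trans ?_ hlt.le) (le_max_left _ _))
      rw [EReal.coe_neg, EReal.neg_le]
      exact hNw x₁ hx₁c
    linarith
  have hx₂t : x₂ ∈ Metric.thickening (d / 2) K₀ := by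
    by_contra hcon
    obtain ⟨z, hz, hvz⟩ := vup x₂
    have := hunif x₂ ⟨hx₂, hcon⟩ z (by rw [dist_comm, dist_eq_norm]; exact hz.trans_le (min_le_left _ _))
    linarith
  have hx₂K' := KK' hx₂
  have hx₂c := K'c hx₂K'
  -- the test function
  obtain ⟨Jv, hJv⟩ := exists_isTwoJet (x := x₂) vsmooth.contDiffAt
  have htest := hJv.add (isTwoJet_jetPoly (η • paraJet y C x₂ + (-M, 0, 0)) x₂)
  set φ := v + fun z => jetPoly (η • paraJet y C x₂ + (-M, 0, 0)) (z - x₂) with hφ_def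
  have hφ : ∀ z, φ z = v z + η * ψ z - M := by
    intro z
    simp only [hφ_def, Pi.add_apply, jetPoly_smul_paraJet_add, add_sub_cancel, hψ]
    ring
  -- The truncation of $w$ is inactive at $x_2$: otherwise $W(x_2)=-N$ and $M\le g/8$.
  have hwx₂ : w x₂ = ((-W x₂ : ℝ) : EReal) := by
    rw [EReal.coe_neg, Wc x₂ hx₂c]
    rcases le_or_gt ((-N : ℝ) : EReal) (-w x₂) with hcase | hcase
    · rw [max_eq_left hcase, neg_neg]
    · exfalso
      have h1 : W x₂ = -N := by
        rw [← EReal.coe_eq_coe_iff, Wc x₂ hx₂c, max_eq_right hcase.le]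
      obtain ⟨z, -, hvz⟩ := vup x₂
      have h2 := v₀N z
      have h3 := mul_nonpos_of_nonneg_of_nonpos hη0.le (ψneg x₂ hx₂c)
      linarith
  have htouch : ∀ᶠ z in 𝓝 x₂, (φ z : EReal) ≤ w z := by
    filter_upwards [Metric.isOpen_thickening.mem_nhds hx₂t] with z hz
    have hzK := Metric.thickening_subset_cthickening _ _ hz
    refine le_trans (EReal.coe_le_coe_iff.2 ?_) (Wle z (K'c (KK' hzK)))
    have h1 : W z + (v z + η * ψ z) ≤ M := hmax hzK
    rw [hφ]
    linarith
  have hFle := hwsup x₂ (hdΩ hx₂K') _ ⟨φ, htest, htouch, by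
    rw [hwx₂, hφ, EReal.coe_eq_coe_iff]; linarith⟩
  have hball : Metric.ball x₂ (min ℓ (d / 2)) ⊆ interior K' := by
    refine subset_trans (fun z hz => ?_)
      (interior_maximal (Metric.thickening_subset_cthickening d K₀) Metric.isOpen_thickening)
    obtain ⟨k, hk, hdist⟩ := Metric.mem_thickening_iff.1 hx₂t
    refine Metric.mem_thickening_iff.2 ⟨k, hk, ?_⟩
    have h1 : dist z x₂ < d / 2 := (Metric.mem_ball.1 hz).trans_le (min_le_right _ _)
    linarith [dist_triangle z x₂ k]
  have hM1 : -M ≤ 0 := by linarith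
  -- The constant $-M\le0$ can only help, $v$ contributes $c$ and $\eta\psi$ the strict excess.
  have hFge : c + η * δF ≤ hjbOp S J₀ (Jv + (η • paraJet y C x₂ + (-M, 0, 0))) := by
    rw [h.le_hjbOp_iff hS_ne]
    intro σ
    have h1 := vsub x₂ hball Jv hJv σ
    have h2 : δF ≤ hjbOp S J₀ (paraJet y C x₂) := hmin hx₂K'
    have h3 := mul_le_mul_of_nonneg_left ((h.le_hjbOp_iff hS_ne).1 h2 σ) hη0.le
    have h4 := jetInner_nonneg_of_psd (hS σ) hM1 (P := 0) Matrix.PosSemidef.zero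
    rw [jetInner_add_right, jetInner_add_right, jetInner_smul_right]
    linarith
  have := mul_pos hη0 hδF0
  linarith

end Comparison

/-! ### Paraboloids adapted to the fundamental cones. -/

section FundamentalFamily

variable {n : ℕ}

theorem matQuad_le (A : symMat n) :
    ∃ κ : ℝ, ∀ h, matQuad A h ≤ κ * ‖h‖ ^ 2 := by
  set T := Matrix.toEuclideanCLM (𝕜 := ℝ) (A : Matrix (Fin n) (Fin n) ℝ)
  refine ⟨‖T‖, fun h => ?_⟩
  calc matQuad A h ≤ ‖T h‖ * ‖h‖ := real_inner_le_norm _ _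
    _ ≤ ‖T‖ * ‖h‖ * ‖h‖ := by gcongr; exact T.le_opNorm h
    _ = ‖T‖ * ‖h‖ ^ 2 := by ring

theorem mem_coneR_iff {R : ℝ} {J : Jet n} :
    J ∈ coneR R ↔ ∀ h, ‖J.2.1‖ / R * ‖h‖ ^ 2 ≤ matQuad J.2.2 h := by
  have : J ∈ coneR R ↔ J.2.2 - (‖J.2.1‖ / R) • symOne n ∈ psd n := Iff.rfl
  rw [this, mem_psd_iff]
  refine forall_congr' fun h => ?_
  rw [matQuad_sub, matQuad_const_smul, matQuad_symOne, sub_nonneg]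

theorem coneR_subset_conePsd {R : ℝ} (hR : 0 ≤ R) : coneR R ⊆ conePsd n := by
  intro J hJ
  rw [mem_coneR_iff] at hJ
  exact (mem_psd_iff _).2 fun h => le_trans (by positivity) (hJ h)

theorem isDirectionalCone_univ : IsDirectionalCone (univ : Set (EuclideanSpace ℝ (Fin n))) :=
  ⟨isClosed_univ, ⟨univ_nonempty, convex_univ, fun _ _ _ _ => mem_univ _⟩, by simp⟩

/-- Polars reverse inclusions, so one three-parameter cone serves for all cases. Since $R$ is
arbitrary here, it can be chosen after the domain. -/
theorem IsConeInfiniteR.exists_subset {M : Set (Jet n)} (hM : IsConeInfiniteR M) :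
    ∃ (γ : ℝ) (D : Set (EuclideanSpace ℝ (Fin n))), 0 ≤ γ ∧ IsDirectionalCone D ∧
      ∀ R, 0 ≤ R → coneGamma γ ∩ coneDir D ∩ coneR R ⊆ M := by
  cases hM with
  | gamma γ hγ => exact ⟨γ, univ, hγ, isDirectionalCone_univ, fun R _ J hJ => hJ.1.1⟩
  | psd => exact ⟨0, univ, le_rfl, isDirectionalCone_univ,
      fun R hR J hJ => coneR_subset_conePsd hR hJ.2⟩
  | dir D hD => exact ⟨0, D, le_rfl, hD, fun R _ J hJ => hJ.1.2⟩
  | gamma_dir γ hγ D hD => exact ⟨γ, D, hγ, hD, fun R _ J hJ => hJ.1⟩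
  | gamma_psd γ hγ => exact ⟨γ, univ, hγ, isDirectionalCone_univ,
      fun R hR J hJ => ⟨hJ.1.1, coneR_subset_conePsd hR hJ.2⟩⟩
  | dir_psd D hD => exact ⟨0, D, le_rfl, hD,
      fun R hR J hJ => ⟨hJ.1.2, coneR_subset_conePsd hR hJ.2⟩⟩
  | gamma_dir_psd γ hγ D hD => exact ⟨γ, D, hγ, hD,
      fun R hR J hJ => ⟨hJ.1, coneR_subset_conePsd hR hJ.2⟩⟩

theorem IsConeFiniteR.exists_subset {R : ℝ} {D : Set (EuclideanSpace ℝ (Fin n))}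
    {M : Set (Jet n)} (hM : IsConeFiniteR R D M) :
    ∃ γ : ℝ, 0 ≤ γ ∧ coneGamma γ ∩ coneDir D ∩ coneR R ⊆ M := by
  cases hM with
  | ball => exact ⟨0, le_rfl, fun J hJ => hJ.2⟩
  | gamma γ hγ => exact ⟨γ, hγ, fun J hJ => ⟨hJ.1.1, hJ.2⟩⟩
  | dir hD => exact ⟨0, le_rfl, fun J hJ => ⟨hJ.1.2, hJ.2⟩⟩
  | gamma_dir γ hγ hD => exact ⟨γ, hγ, fun J hJ => hJ⟩

/-- A bounded set is contained in a translate of a truncated directional cone. -/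
theorem IsDirectionalCone.exists_translate {D : Set (EuclideanSpace ℝ (Fin n))}
    (hD : IsDirectionalCone D) {Ω : Set (EuclideanSpace ℝ (Fin n))}
    (hΩ : Bornology.IsBounded Ω) :
    ∃ (y : EuclideanSpace ℝ (Fin n)) (R : ℝ), 0 < R ∧
      ∀ x ∈ Ω, x - y ∈ D ∩ Metric.ball 0 R := by
  obtain ⟨-, ⟨-, -, hcone⟩, ⟨d, hd⟩⟩ := hD
  obtain ⟨r, hr, hball⟩ := Metric.mem_nhds_iff.1 (mem_interior_iff_mem_nhds.1 hd)
  obtain ⟨ρ, hρ, hΩρ⟩ := hΩ.subset_ball_lt 0 0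
  -- Scaling by $t$ turns the ball of radius $r$ around $d$ inside $\mathcal D$ into one of radius
  -- $\rho$ around $td$.
  set t := ρ / r with ht
  have ht0 : 0 < t := by positivity
  refine ⟨-(t • d), t * ‖d‖ + ρ, by positivity, fun x hx => ?_⟩
  have hxρ : ‖x‖ < ρ := mem_ball_zero_iff.1 (hΩρ hx)
  rw [sub_neg_eq_add]
  constructor
  · have e : x + t • d = t • (d + t⁻¹ • x) := by
      rw [smul_add, smul_smul, mul_inv_cancel₀ ht0.ne', one_smul, add_comm]
    rw [e]
    refine hcone t ht0.le _ (hball ?_)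
    rw [mem_ball_iff_norm, add_sub_cancel_left, norm_smul, Real.norm_of_nonneg (by positivity),
      inv_mul_lt_iff₀ ht0, ht, div_mul_cancel₀ _ hr.ne']
    exact hxρ
  · rw [mem_ball_zero_iff]
    refine (norm_add_le _ _).trans_lt ?_
    rw [norm_smul, Real.norm_of_nonneg ht0.le]
    linarith

variable {ι : Type*} [Nonempty ι] {S : ι → Jet n} {J₀ : Jet n}

theorem IsPointedWithAxis.hjbOp_paraJet_pos (h : IsPointedWithAxis S J₀) (hS_ne : ∀ σ, S σ ≠ 0)
    {γ R C : ℝ} {D : Set (EuclideanSpace ℝ (Fin n))} {x y : EuclideanSpace ℝ (Fin n)}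
    (hpolar : range S ⊆ polarCone (coneGamma γ ∩ coneDir D ∩ coneR R)) (hR : 0 < R)
    (hxD : x - y ∈ interior D) (hxR : ‖x - y‖ < R)
    (hC : ‖x - y‖ ^ 2 / 2 - C < -γ * ‖x - y‖) : 0 < hjbOp S J₀ (paraJet y C x) := by
  obtain ⟨κ, hκ⟩ := matQuad_le J₀.2.2
  have lim : ∀ {f : ℝ → ℝ}, Continuous f → 0 < f 0 → ∀ᶠ δ in 𝓝[>] (0 : ℝ), 0 < f δ :=
    fun hf h0 => nhdsWithin_le_nhds (hf.continuousAt.eventually (lt_mem_nhds h0))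
  have h1 : ∀ᶠ δ in 𝓝[>] (0 : ℝ), 0 < -γ * ‖x - y - δ • J₀.2.1‖
      - (‖x - y‖ ^ 2 / 2 - C - δ * J₀.1) := by
    refine lim (by fun_prop) ?_
    simp only [zero_smul, sub_zero, zero_mul]
    linarith
  have h2 : ∀ᶠ δ in 𝓝[>] (0 : ℝ), 0 < 1 - δ * κ - ‖x - y - δ • J₀.2.1‖ / R := by
    refine lim (by fun_prop) ?_
    simp only [zero_smul, sub_zero, zero_mul, sub_pos]
    rwa [div_lt_one hR]
  have h3 : ∀ᶠ δ in 𝓝[>] (0 : ℝ), x - y - δ • J₀.2.1 ∈ D := by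
    have : Tendsto (fun δ : ℝ => x - y - δ • J₀.2.1) (𝓝 0) (𝓝 (x - y - (0 : ℝ) • J₀.2.1)) :=
      Continuous.tendsto (by fun_prop) _
    rw [zero_smul, sub_zero] at this
    exact nhdsWithin_le_nhds (this.eventually (mem_interior_iff_mem_nhds.1 hxD))
  obtain ⟨δ, ⟨⟨hδ1, hδ2⟩, hδ3⟩, hδ⟩ := (((h1.and h2).and h3).and self_mem_nhdsWithin).exists
  have hδ0 : 0 < δ := hδ
  -- The three strict hypotheses put the jet in the interior of the cone, leaving room for $-\delta
  -- J_0$. Pairing with $J_\sigma$ then gives $F\ge\delta$.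
  have hmem : paraJet y C x - δ • J₀ ∈ coneGamma γ ∩ coneDir D ∩ coneR R := by
    refine ⟨⟨?_, hδ3⟩, mem_coneR_iff.2 fun v => ?_⟩
    · change ‖x - y‖ ^ 2 / 2 - C - δ * J₀.1 ≤ -γ * ‖x - y - δ • J₀.2.1‖
      linarith
    · change ‖x - y - δ • J₀.2.1‖ / R * ‖v‖ ^ 2 ≤ matQuad (symOne n - δ • J₀.2.2) v
      rw [matQuad_sub, matQuad_const_smul, matQuad_symOne]
      have a1 := mul_le_mul_of_nonneg_left (hκ v) hδ0.le
      have a2 := mul_nonneg hδ2.le (sq_nonneg ‖v‖)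
      linarith
  refine hδ0.trans_le ((h.le_hjbOp_iff hS_ne).2 fun σ => ?_)
  have h4 := hpolar (mem_range_self σ) _ hmem
  rw [jetInner_sub_right, jetInner_smul_right] at h4
  linarith

theorem IsPointedWithAxis.comparisonPrinciple_of_polar (h : IsPointedWithAxis S J₀)
    (hS_ne : ∀ σ, S σ ≠ 0) (hS : ∀ σ, S σ ∈ properEllipticCoeffs n)
    {γ R : ℝ} {D : Set (EuclideanSpace ℝ (Fin n))} (hγ : 0 ≤ γ) (hR : 0 < R)
    (hpolar : range S ⊆ polarCone (coneGamma γ ∩ coneDir D ∩ coneR R)) (c : ℝ)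
    {Ω : Set (EuclideanSpace ℝ (Fin n))} (hΩ : IsOpen Ω) {y : EuclideanSpace ℝ (Fin n)}
    (hy : ∀ x ∈ Ω, x - y ∈ D ∩ Metric.ball 0 R) : ComparisonPrinciple (hjbOp S J₀) c Ω := by
  have hyR : ∀ x ∈ Ω, ‖x - y‖ < R := fun x hx => mem_ball_zero_iff.1 (hy x hx).2
  have hsub : Ω ⊆ Metric.closedBall y R := fun x hx => by
    rw [mem_closedBall_iff_norm]; exact (hyR x hx).le
  refine h.comparisonPrinciple_of_paraJet hS_ne hS c hΩ (Metric.isBounded_closedBall.subset hsub)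
    -- With this $C$, $\psi\le-\gamma R-1<-\gamma|x-y|$ on $\Omega$.
    (y := y) (C := R ^ 2 / 2 + γ * R + 1) (fun x hx => ?_) (fun x hx => ?_)
  · have h1 : ‖x - y‖ ≤ R := mem_closedBall_iff_norm.1
      (closure_minimal hsub Metric.isClosed_closedBall hx)
    have h2 : ‖x - y‖ ^ 2 ≤ R ^ 2 := by gcongr
    have h3 : 0 ≤ γ * R := by positivity
    linarith
  · refine h.hjbOp_paraJet_pos hS_ne hpolar hR ?_ (hyR x hx) ?_
    -- The translate $\Omega-y$ is open and contained in $\mathcal D$, hence in its interior.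
    · have hopen : IsOpen ((fun z => z + y) ⁻¹' Ω) := hΩ.preimage (by fun_prop)
      refine _root_.mem_interior.2 ⟨_, fun z hz => ?_, hopen, ?_⟩
      · have := (hy _ hz).1
        rwa [add_sub_cancel_right] at this
      · change x - y + y ∈ Ω
        rwa [sub_add_cancel]
    · have h1 := hyR x hx
      have h2 : ‖x - y‖ ^ 2 ≤ R ^ 2 := by gcongr
      have h3 : γ * ‖x - y‖ ≤ γ * R := by gcongr
      linarith

end FundamentalFamily

theorem mainTheorem11 (n : ℕ) {ι : Type*} [Nonempty ι] (S : ι → Jet n)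
    (hS_ne : ∀ σ, S σ ≠ 0) (hS : ∀ σ, S σ ∈ properEllipticCoeffs n) :
    -- the intersection is a (convex cone) subequation iff the family is pointed
    (IsConvexCone (⋂ σ, halfSpace (S σ)) ∧
      (IsSubequation (⋂ σ, halfSpace (S σ)) ↔ ∃ J₀ : Jet n, IsPointedWithAxis S J₀)) ∧
    ∀ J₀ : Jet n, IsPointedWithAxis S J₀ →
      -- each normalized linear operator is the canonical operator of its half-space
      (∀ σ, IsConvexConeSubequation (halfSpace (S σ)) ∧
        IsCanonicalOperator (halfSpace (S σ)) J₀ (normalizedOp (S σ) J₀)) ∧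
      -- the intersection is its own maximal monotonicity cone
      IsConvexConeSubequation (⋂ σ, halfSpace (S σ)) ∧
      maxMonotonicityCone (⋂ σ, halfSpace (S σ)) = ⋂ σ, halfSpace (S σ) ∧
      -- the infimum is finite, and it is the canonical operator of the intersection
      (∀ J : Jet n, BddBelow (Set.range fun σ => normalizedOp (S σ) J₀ J)) ∧
      IsCanonicalOperator (⋂ σ, halfSpace (S σ)) J₀ (hjbOp S J₀) ∧
      ConcaveOn ℝ Set.univ (hjbOp S J₀) ∧ Continuous (hjbOp S J₀) ∧
      -- comparison on all bounded domains, for the cones with infinite `R`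
      (∀ M : Set (Jet n), IsConeInfiniteR M → Set.range S ⊆ polarCone M →
        ∀ (c : ℝ) (Ω : Set (EuclideanSpace ℝ (Fin n))), IsOpen Ω → Bornology.IsBounded Ω →
          ComparisonPrinciple (hjbOp S J₀) c Ω) ∧
      -- comparison on domains in a translate of the truncated cone, for finite `R`
      (∀ (R : ℝ) (D : Set (EuclideanSpace ℝ (Fin n))) (M : Set (Jet n)), 0 < R →
        IsConeFiniteR R D M → Set.range S ⊆ polarCone M →
        ∀ (c : ℝ) (Ω : Set (EuclideanSpace ℝ (Fin n))), IsOpen Ω →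
          (∃ y : EuclideanSpace ℝ (Fin n), Ω ⊆ (fun x => y + x) '' (D ∩ Metric.ball 0 R)) →
          ComparisonPrinciple (hjbOp S J₀) c Ω) := by
  refine ⟨⟨isConvexCone_iInter_halfSpace S, exists_isPointedWithAxis_of_isSubequation hS_ne,
    fun ⟨J₀, h⟩ => (h.isConvexConeSubequation hS_ne hS).1⟩, fun J₀ h =>
    ⟨h.halfSpace_properties hS_ne hS, h.isConvexConeSubequation hS_ne hS,
    maxMonotonicityCone_eq_of_isConvexCone (isConvexCone_iInter_halfSpace S),
    h.bddBelow_normalizedOp hS_ne, h.isCanonicalOperator hS_ne hS, h.concaveOn_hjbOp hS_ne,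
    h.continuous_hjbOp hS_ne, fun M hM hpolar c Ω hΩ hbdd => ?_,
    fun R D M hR hM hpolar c Ω hΩ ⟨y, hy⟩ => ?_⟩⟩
  · obtain ⟨γ, D, hγ, hD, hsub⟩ := hM.exists_subset
    obtain ⟨y, R, hR, hy⟩ := hD.exists_translate hbdd
    exact h.comparisonPrinciple_of_polar hS_ne hS hγ hR
      (fun J hJ J' hJ' => hpolar hJ J' (hsub R hR.le hJ')) c hΩ hy
  · obtain ⟨γ, hγ, hsub⟩ := hM.exists_subset
    refine h.comparisonPrinciple_of_polar hS_ne hS hγ hR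
      (fun J hJ J' hJ' => hpolar hJ J' (hsub hJ')) c hΩ (y := y) fun x hx => ?_
    obtain ⟨z, hz, rfl⟩ := hy hx
    rwa [add_sub_cancel_left]
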